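/- Let $N_t,N_x\ge 1$ and $N_\gamma$ be integers, put $\gamma=2\pi N_\gamma/N_x$, and consider the square lattice with nodes $(t,x)$, $0\le t<N_t$, $x\in\mathbb Z/N_x$, on the twisted torus, i.e. with the identification $(N_t,x)\equiv(0,x+N_\gamma)$. For group elements $h^{(h)}_{t,x},h^{(v)}_{t,x}\in \mathrm{SU}(2)$ on the horizontal links $(t,x)\to(t,x+1)$ and the vertical links $(t,x)\to(t+1,x)$, and spins $T_{t,x},L_{t,x}\in\frac12\mathbb N$ on these links, let $$\psi^{T,L}_{LS}(h)=\int_{\mathrm{SU}(2)^{N_tN_x}}\prod_{t,x}dg_{t,x}\,\langle\uparrow|g_{t,x+1}^{-1}h^{(h)}_{t,x}g_{t,x}|\uparrow\rangle^{2T_{t,x}}\,\langle+|g_{t+1,x}^{-1}h^{(v)}_{t,x}g_{t,x}|+\rangle^{2L_{t,x}},$$ with normalised Haar measure, $|\uparrow\rangle=(1,0)$ and $|+\rangle=(1,1)/\sqrt2$. For complex couplings $\lambda,\tau$ the coherent spin network state is $$\psi_{\lambda,\tau}(h)=\sum_{T,L}\ \prod_{t,x}\frac{\lambda^{2L_{t,x}}\tau^{2T_{t,x}}}{(2L_{t,x})!\,(2T_{t,x})!}\,(J_{t,x}+1)!\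 \psi^{T,L}_{LS}(h),\qquad J_{t,x}=T_{t,x}+L_{t,x}+T_{t,x-1}+L_{t-1,x},$$ where $n!=\Gamma(n+1)$; outside of the domain of convergence it is defined by analytic continuation in $(\lambda,\tau)\in\mathbb C^2$ from the origin, over connected open sets containing the origin. The Ponzano–Regge amplitude of the solid twisted torus is $$Z(\lambda,\tau)=\int_{\mathrm{SU}(2)}dH\,\psi_{\lambda,\tau}(h_H),$$ where $h_H$ has $h^{(v)}_{N_t-1,x}=H$ for all $x$ and the identity on all other links. For $\varphi\in\mathbb R$ and integers $\omega,k\ge0$ put $\theta_{\omega,k}(\varphi)=(\varphi+2\pi\omega-\gamma k)/N_t$ and $Q_{\omega,k}(\varphi)=\mathbb I_2-\tau e^{i\frac{2\pi k}{N_x}\sigma_z}-\lambda e^{i\theta_{\omega,k}(\varphi)\sigma_x}$. (i) For all $\lambda,\tau\in\mathbb C$, $\varphi\in\mathbb R$ and $\omega,k\ge 0$, $$\det Q_{\omega,k}(\varphi)=1+\lambda^2+\tau^2-2\tau\cos\tfrac{2\pi k}{N_x}-2\lambda\cos\theta_{\omega,k}(\varphi)+2\lambda\tau\cos\tfrac{2\pi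 k}{N_x}\cos\theta_{\omega,k}(\varphi).$$ (ii) If $|\lambda|+|\tau|<1$, then $\det Q_{\omega,k}(\varphi)\neq0$ for all $\varphi,\omega,k$, and for every $H\in\mathrm{SU}(2)$ the series for $\psi_{\lambda,\tau}(h_H)$ converges absolutely and its sum is the value of the continued state. (iii) Let $\lambda,\tau\in\mathbb C$ be such that, for some $\varphi\in\mathbb R$, all the determinants $\det Q_{\omega,k}(\varphi)$ with $0\le\omega<N_t$, $0\le k<N_x$ are nonzero. Then for almost every $H\in\mathrm{SU}(2)$ the state $\psi_{\lambda,\tau}(h_H)$ exists, and is unique, as the value of an analytic continuation; the function $H\mapsto\psi_{\lambda,\tau}(h_H)$ is Haar integrable if and only if the integrand of the right-hand side below is integrable over $[0,2\pi]$; and $$Z(\lambda,\tau)=\frac1\pi\int_0^{2\pi}d\varphi\,\sin^2\varphi\,\prod_{\omega=0}^{N_t-1}\prod_{k=0}^{N_x-1}\frac1{\det Q_{\omega,k}(\varphi)},$$ where, if the two integrands are not integrable, both integrals are read as $0$. -/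

import Mathlib

open MeasureTheory
open scoped Matrix

namespace PonzanoRegge

noncomputable section

/-! ### The compact group `SU(2)` and its normalised Haar measure -/

/-- The group `SU(2)` of special unitary `2 × 2` complex matrices. -/
abbrev SU2 : Type := Matrix.specialUnitaryGroup (Fin 2) ℂ

instance : IsTopologicalGroup SU2 where
  continuous_inv :=
    Continuous.subtype_mk (continuous_subtype_val.star) _

instance : CompactSpace SU2 := by
  have hc : IsCompact {A : Matrix (Fin 2) (Fin 2) ℂ | A ∈ Matrix.specialUnitaryGroup (Fin 2) ℂ} := by
    have hK : IsCompact (Set.univ.pi fun _ : Fin 2 => Set.univ.pi fun _ : Fin 2 =>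
        Metric.closedBall (0 : ℂ) 1) :=
      isCompact_univ_pi fun _ => isCompact_univ_pi fun _ => isCompact_closedBall _ _
    refine IsCompact.of_isClosed_subset hK ?_ ?_
    · have h1 : IsClosed {A : Matrix (Fin 2) (Fin 2) ℂ | A * star A = 1 ∧ A.det = 1} :=
        (isClosed_eq (continuous_id.mul continuous_id.star) continuous_const).inter
          (isClosed_eq continuous_id.matrix_det continuous_const)
      convert h1 using 1
      ext A
      simp [Matrix.mem_specialUnitaryGroup_iff, Matrix.mem_unitaryGroup_iff]
    · intro A hA i _ j _
      exact mem_closedBall_zero_iff.mpr (entry_norm_bound_of_unitary hA.1 i j)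
  exact isCompact_iff_compactSpace.mp hc

instance : MeasurableSpace SU2 := borel SU2

instance : BorelSpace SU2 := ⟨rfl⟩

/-- The Haar measure of `SU(2)`, normalised to total mass one. -/
def haarSU2 : Measure SU2 := Measure.haarMeasure ⊤

/-! ### The square lattice on the twisted torus -/

/-- The nodes `(t, x)` of the boundary graph: `Nt` time slices with `Nx` nodes each; the space
coordinate is periodic. -/
abbrev Node (Nt Nx : ℕ) : Type := Fin Nt × ZMod Nx

variable {Nt Nx : ℕ}

/-- The node `(t, x + 1)`. -/
def spaceSucc (n : Node Nt Nx) : Node Nt Nx := (n.1, n.2 + 1)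

/-- The node `(t, x - 1)`. -/
def spacePred (n : Node Nt Nx) : Node Nt Nx := (n.1, n.2 - 1)

/-- The node `(t + 1, x)`, with the twisted identification `(Nt, x) ≡ (0, x + Nγ)`. -/
def timeSucc (Nγ : ℤ) (n : Node Nt Nx) : Node Nt Nx :=
  if h : n.1.val + 1 < Nt then (⟨n.1.val + 1, h⟩, n.2)
  else (⟨0, n.1.pos⟩, n.2 + (Nγ : ZMod Nx))

/-- The node `(t - 1, x)`, with the twisted identification `(-1, x) ≡ (Nt - 1, x - Nγ)`. -/
def timePred (Nγ : ℤ) (n : Node Nt Nx) : Node Nt Nx :=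
  if n.1.val = 0 then (⟨Nt - 1, Nat.sub_one_lt_of_lt n.1.pos⟩, n.2 - (Nγ : ZMod Nx))
  else (⟨n.1.val - 1, lt_of_le_of_lt (Nat.sub_le _ _) n.1.isLt⟩, n.2)

theorem timePred_timeSucc (Nγ : ℤ) (n : Node Nt Nx) : timePred Nγ (timeSucc Nγ n) = n := by
  obtain ⟨⟨t, ht⟩, x⟩ := n
  by_cases h : t + 1 < Nt
  · simp [timePred, timeSucc, h]
  · have : Nt - 1 = t := by omega
    simp [timePred, timeSucc, h, this]

theorem timeSucc_timePred (Nγ : ℤ) (n : Node Nt Nx) : timeSucc Nγ (timePred Nγ n) = n := by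
  obtain ⟨⟨t, ht⟩, x⟩ := n
  by_cases h : t = 0
  · subst h
    have : ¬ (Nt - 1 + 1 < Nt) := by omega
    simp [timePred, timeSucc, this]
  · have h1 : t - 1 + 1 = t := by omega
    simp [timePred, timeSucc, h, h1, ht]

/-! ### Coherent spin network states -/

/-- The spinor `|↑⟩`. -/
def spinUp : Fin 2 → ℂ := ![1, 0]

/-- The spinor `|+⟩ = (|↑⟩ + |↓⟩) / √2`. -/
def spinPlus : Fin 2 → ℂ := ![1 / (Real.sqrt 2 : ℂ), 1 / (Real.sqrt 2 : ℂ)]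

/-- The diagonal matrix element `⟨ξ| g |ξ⟩`. -/
def matElem (ξ : Fin 2 → ℂ) (g : SU2) : ℂ := star ξ ⬝ᵥ ((g : Matrix (Fin 2) (Fin 2) ℂ) *ᵥ ξ)

/-- Group elements on the links of the lattice: `hor n` sits on the horizontal (space) link and
`ver n` on the vertical (time) link going out of the node `n`. -/
structure Holonomies (Nt Nx : ℕ) where
  hor : Node Nt Nx → SU2
  ver : Node Nt Nx → SU2

/-- Spins on the links, recorded by their doubles: the horizontal link going out of `n` carries the
spin `T n = twoT n / 2` and the vertical one the spin `L n = twoL n / 2`. -/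
abbrev Spins (Nt Nx : ℕ) : Type := (Node Nt Nx → ℕ) × (Node Nt Nx → ℕ)

/-- The double `2T` of the spin of the horizontal link going out of a node. -/
def twoT (s : Spins Nt Nx) : Node Nt Nx → ℕ := s.1

/-- The double `2L` of the spin of the vertical link going out of a node. -/
def twoL (s : Spins Nt Nx) : Node Nt Nx → ℕ := s.2

/-- The sum `J` of the four spins around a node, a half-integer. -/
def spinSum (Nγ : ℤ) (s : Spins Nt Nx) (n : Node Nt Nx) : ℝ :=
  (twoT s n + twoL s n + twoT s (spacePred n) + twoL s (timePred Nγ n) : ℝ) / 2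

variable [NeZero Nt] [NeZero Nx]

/-- The Livine-Speziale spin network at fixed spins, glued from coherent intertwiners with the
spinors `|↑⟩` along the space links and `|+⟩` along the time links, by group averaging at every
node. -/
def lsState (Nγ : ℤ) (s : Spins Nt Nx) (h : Holonomies Nt Nx) : ℂ :=
  ∫ g : Node Nt Nx → SU2,
    ∏ n, matElem spinUp ((g (spaceSucc n))⁻¹ * h.hor n * g n) ^ twoT s n *
      matElem spinPlus ((g (timeSucc Nγ n))⁻¹ * h.ver n * g n) ^ twoL s n
    ∂(Measure.pi fun _ => haarSU2)

/-- The weight of a spin configuration in the coherent superposition: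
`∏ λ ^ (2L) τ ^ (2T) / ((2L)! (2T)!) * (J + 1)!`, where `(J + 1)! = Γ(J + 2)`. -/
def spinWeight (Nγ : ℤ) (lam tau : Node Nt Nx → ℂ) (s : Spins Nt Nx) : ℂ :=
  ∏ n, lam n ^ twoL s n * tau n ^ twoT s n /
      ((Nat.factorial (twoL s n) : ℂ) * (Nat.factorial (twoT s n) : ℂ)) *
    ((Real.Gamma (spinSum Nγ s n + 2) : ℝ) : ℂ)

/-- The term of the coherent spin network series at given spins. -/
def coherentTerm (Nγ : ℤ) (lam tau : Node Nt Nx → ℂ) (h : Holonomies Nt Nx)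
    (s : Spins Nt Nx) : ℂ :=
  spinWeight Nγ lam tau s * lsState Nγ s h

/-- The coherent spin network wave-function, as the sum of its series over all spins. -/
def coherentSeries (Nγ : ℤ) (lam tau : Node Nt Nx → ℂ) (h : Holonomies Nt Nx) : ℂ :=
  ∑' s : Spins Nt Nx, coherentTerm Nγ lam tau h s

/-- `z` is a value at `p` of an analytic continuation of the germ of `f` at the origin of `ℂ²`:
it is the value at `p` of an analytic function on a connected open set containing `0` and `p`
which agrees with `f` near `0`. -/
def IsContinuedValue (f : ℂ × ℂ → ℂ) (p : ℂ × ℂ) (z : ℂ) : Prop :=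
  ∃ U : Set (ℂ × ℂ), IsOpen U ∧ IsConnected U ∧ (0 : ℂ × ℂ) ∈ U ∧ p ∈ U ∧
    ∃ F : ℂ × ℂ → ℂ, AnalyticOnNhd ℂ F U ∧ F =ᶠ[nhds 0] f ∧ F p = z

open Classical in
/-- The value at `p` of the analytic continuation of `f` from the origin (`0` where there is no
continuation). -/
def continuedValue (f : ℂ × ℂ → ℂ) (p : ℂ × ℂ) : ℂ :=
  if h : ∃ z, IsContinuedValue f p z then h.choose else 0

/-- The coherent spin network series with homogeneous couplings, as a function of the pair
`(λ, τ)`. -/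
def homogeneousSeries (Nγ : ℤ) (h : Holonomies Nt Nx) (p : ℂ × ℂ) : ℂ :=
  coherentSeries Nγ (fun _ => p.1) (fun _ => p.2) h

/-- The coherent spin network boundary state with homogeneous couplings `λ, τ`: the analytic
continuation in the couplings of the series over the spins. -/
def boundaryState (Nγ : ℤ) (lam tau : ℂ) (h : Holonomies Nt Nx) : ℂ :=
  continuedValue (homogeneousSeries Nγ h) (lam, tau)

/-! ### The Ponzano-Regge amplitude of the solid torus -/

/-- The flat connection with holonomy `H` around the non-contractible cycle: all links carry the
identity, except for the vertical links of the last time slice, which carry `H`. -/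
def torusHolonomies (Nt Nx : ℕ) (H : SU2) : Holonomies Nt Nx where
  hor _ := 1
  ver n := if n.1.val + 1 = Nt then H else 1

/-- The Ponzano-Regge amplitude of the solid torus for a boundary state `ψ`: the integral of the
wave-function over the holonomy around the non-contractible cycle. -/
def amplitude (ψ : Holonomies Nt Nx → ℂ) : ℂ :=
  ∫ H : SU2, ψ (torusHolonomies Nt Nx H) ∂haarSU2

/-! ### Mode matrices -/

/-- The angle `θ = (φ + 2πω - γk) / Nt`, with the twist angle `γ = 2π Nγ / Nx`. -/
def modeAngle (Nt Nx : ℕ) (Nγ : ℤ) (φ : ℝ) (ω k : ℕ) : ℝ :=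
  (φ + 2 * Real.pi * ω - 2 * Real.pi * (Nγ / Nx) * k) / Nt

/-- The mode matrix `Q = 1 - τ exp(i (2πk / Nx) σ_z) - λ exp(i θ σ_x)`. -/
def modeMatrix (Nt Nx : ℕ) (Nγ : ℤ) (lam tau : ℂ) (φ : ℝ) (ω k : ℕ) :
    Matrix (Fin 2) (Fin 2) ℂ :=
  1 - tau • !![Complex.exp (Complex.I * (2 * Real.pi * k / Nx : ℝ)), 0;
               0, Complex.exp (-(Complex.I * (2 * Real.pi * k / Nx : ℝ)))]
    - lam • !![(Real.cos (modeAngle Nt Nx Nγ φ ω k) : ℂ),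
                 Complex.I * (Real.sin (modeAngle Nt Nx Nγ φ ω k) : ℂ);
               Complex.I * (Real.sin (modeAngle Nt Nx Nγ φ ω k) : ℂ),
                 (Real.cos (modeAngle Nt Nx Nγ φ ω k) : ℂ)]

/-- The integrand `sin² φ ∏_{ω, k} 1 / det Q_{ω, k}(φ)` of the class angle integral. -/
def classAngleIntegrand (Nt Nx : ℕ) (Nγ : ℤ) (lam tau : ℂ) (φ : ℝ) : ℂ :=
  (Real.sin φ : ℂ) ^ 2 *
    ∏ ω ∈ Finset.range Nt, ∏ k ∈ Finset.range Nx, 1 / (modeMatrix Nt Nx Nγ lam tau φ ω k).det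

end

end PonzanoRegge

/-! The weight `(J+1)! = Γ(J+2)` is a Gaussian moment. Identify ℝ⁴ with the quaternions, so that
unit vectors form SU(2). Under the measure π⁻² exp(-|x|²) |x|^(2J) dx the direction of x is Haar
distributed and the total mass is Γ(J+2) (`map_dir_radialMeasure`). Each weighted node average is
therefore an integral over ℝ⁴, and its 2J powers of the norm, shared among the four links at the
node, turn matrix elements into bilinear forms. The sum over spins becomes a product of exponential
series, and the state is the Gaussian integral of exp(-action) (`hasSum_coherentTerm`), convergent
for |λ| + |τ| < 1.

The square of this integral is the inverse determinant of the action matrix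
(`gaussianState_sq_mul_det`). After complexification a node variable is an arbitrary 2×2 matrix: the
holonomies act on its left index and the spinor projectors on its right one. On a flat connection of
class angle φ, twisted plane waves times eigenvectors of H diagonalise the left index and leave on
the right one a 2×2 block with the determinant of a mode matrix. The two eigenvalues exp(±iφ) give
the same product D of mode determinants, so the action has determinant D²
(`det_actionMatrix_torusHolonomies`). Hence ψD = ±1, and continuity along the segment from zero
couplings selects +1 (`gaussianState_mul_modeDet`).

As D is entire in (λ, τ) with D(0) = 1, the state continues to 1/D, uniquely and exactly where D ≠
0: a complex line through the origin meets D = 0 in a countable set, which does not separate it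
(`isContinuedValue_iff`). Finally, the same Gaussian in polar coordinates gives the class angle the
law (2/π) sin²φ dφ on (0, π) (`map_classAngle_haarSU2`); the symmetry φ ↦ 2π - φ doubles the
interval. Being real analytic in φ, D vanishes for countably many angles at most once it is nonzero
at one of them. -/

/-! ### Complex Gaussian integrals in finite dimension. -/

/-- Simultaneous diagonalisation of a positive definite and a symmetric real matrix. -/
theorem Matrix.PosDef.exists_simultaneous_diagonalization {ι : Type*} [Fintype ι] [DecidableEq ι]
    {R S : Matrix ι ι ℝ} (hR : R.PosDef) (hS : S.IsHermitian) :
    ∃ (B : Matrix ι ι ℝ) (d : ι → ℝ), Bᵀ * R * B = 1 ∧ Bᵀ * S * B = Matrix.diagonal d := by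
  have key : ∀ (T : Matrix ι ι ℝ) (hT : T.IsHermitian), ∃ U : Matrix ι ι ℝ,
      Uᵀ * U = 1 ∧ Uᵀ * T * U = Matrix.diagonal hT.eigenvalues := by
    intro T hT
    refine ⟨hT.eigenvectorUnitary, ?_, ?_⟩
    · have := (Matrix.mem_unitaryGroup_iff').1 hT.eigenvectorUnitary.2
      simpa [Matrix.star_eq_conjTranspose] using this
    · have := hT.conjStarAlgAut_star_eigenvectorUnitary
      simpa [Unitary.conjStarAlgAut_apply, Matrix.star_eq_conjTranspose] using this
  obtain ⟨U, hU, hUR⟩ := key R hR.1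
  set e := hR.1.eigenvalues
  have he : ∀ i, 0 < e i := hR.eigenvalues_pos
  -- Rescaling the eigenbasis of `R` by the inverse square roots of its eigenvalues makes `R` the
  -- identity. An orthogonal change of basis preserves this and can be spent on diagonalising `S`.
  set C : Matrix ι ι ℝ := U * Matrix.diagonal fun i => (Real.sqrt (e i))⁻¹ with hC
  have hCR : Cᵀ * R * C = 1 := by
    have : Cᵀ * R * C = Matrix.diagonal (fun i => (Real.sqrt (e i))⁻¹) * (Uᵀ * R * U) *
        Matrix.diagonal fun i => (Real.sqrt (e i))⁻¹ := by
      simp only [hC, Matrix.transpose_mul, Matrix.diagonal_transpose, Matrix.mul_assoc]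
    rw [this, hUR, Matrix.diagonal_mul_diagonal, Matrix.diagonal_mul_diagonal, ← Matrix.diagonal_one]
    congr 1
    ext i
    have h1 := Real.mul_self_sqrt (he i).le
    have h2 : Real.sqrt (e i) ≠ 0 := (Real.sqrt_pos.2 (he i)).ne'
    field_simp
    nlinarith
  have hS' : (Cᵀ * S * C).IsHermitian := by
    have := Matrix.isHermitian_conjTranspose_mul_mul C hS
    simpa using this
  obtain ⟨V, hV, hVS⟩ := key _ hS'
  refine ⟨C * V, hS'.eigenvalues, ?_, ?_⟩
  · have : (C * V)ᵀ * R * (C * V) = Vᵀ * (Cᵀ * R * C) * V := by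
      simp only [Matrix.transpose_mul, Matrix.mul_assoc]
    rw [this, hCR, Matrix.mul_one, hV]
  · rw [← hVS]
    simp only [Matrix.transpose_mul, Matrix.mul_assoc]

/-- The square of a complex Gaussian integral. -/
theorem sq_integral_exp_neg_quadratic_mul_det {ι : Type*} [Fintype ι] [DecidableEq ι]
    (M : Matrix ι ι ℂ) (hM : M.IsSymm)
    (hpos : ∀ x : ι → ℝ, x ≠ 0 → 0 < (((fun i => (x i : ℂ)) ⬝ᵥ (M *ᵥ fun i => (x i : ℂ)))).re) :
    (∫ x : ι → ℝ, Complex.exp (-((fun i => (x i : ℂ)) ⬝ᵥ (M *ᵥ fun i => (x i : ℂ))))) ^ 2 * M.det =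
      (Real.pi : ℂ) ^ Fintype.card ι := by
  set R : Matrix ι ι ℝ := M.map Complex.re with hRdef
  set S : Matrix ι ι ℝ := M.map Complex.im with hSdef
  have hMRS : M = R.map (fun r => (r : ℂ)) + Complex.I • S.map (fun r => (r : ℂ)) := by
    ext i j
    simp [hRdef, hSdef, mul_comm Complex.I, Complex.re_add_im]
  have hRs : R.IsHermitian := by
    ext i j; simp [hRdef, hM.apply i j]
  have hSs : S.IsHermitian := by
    ext i j; simp [hSdef, hM.apply i j]
  have hR : R.PosDef := by
    refine Matrix.PosDef.of_dotProduct_mulVec_pos hRs fun x hx => ?_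
    have := hpos x hx
    refine this.trans_eq ?_
    simp [dotProduct, Matrix.mulVec, hRdef, Complex.re_sum, Finset.mul_sum]
  -- In the coordinates x = By the form is ∑ (1 + i dᵢ) yᵢ², so the integral splits into
  -- one-dimensional Gaussians.
  obtain ⟨B, d, hB1, hB2⟩ := hR.exists_simultaneous_diagonalization hSs
  have hdetB : B.det ≠ 0 := by
    intro h
    have := congrArg Matrix.det hB1
    simp [h] at this
  set Bc : Matrix ι ι ℂ := B.map (fun r => (r : ℂ)) with hBc
  have hcast : ∀ X Y : Matrix ι ι ℝ, (X * Y).map (fun r => (r : ℂ)) =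
      X.map (fun r => (r : ℂ)) * Y.map (fun r => (r : ℂ)) := by
    intro X Y; ext i j; simp [Matrix.mul_apply]
  have hdiag : Bcᵀ * M * Bc = Matrix.diagonal fun i => (1 + Complex.I * d i : ℂ) := by
    have e1 := congrArg (fun X : Matrix ι ι ℝ => X.map (fun r => (r : ℂ))) hB1
    have e2 := congrArg (fun X : Matrix ι ι ℝ => X.map (fun r => (r : ℂ))) hB2
    simp only [hcast] at e1 e2
    have : Bcᵀ * M * Bc = Bᵀ.map (fun r => (r : ℂ)) * R.map (fun r => (r : ℂ)) * Bc +
        Complex.I • (Bᵀ.map (fun r => (r : ℂ)) * S.map (fun r => (r : ℂ)) * Bc) := by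
      rw [hMRS, Matrix.mul_add, Matrix.add_mul, Matrix.mul_smul, Matrix.smul_mul]
      rfl
    rw [this, e1, e2]
    ext i j
    by_cases hij : i = j
    · subst hij; simp
    · simp [hij]
  have hdetBc : Bc.det = (B.det : ℂ) := by
    have := (RingHom.map_det Complex.ofRealHom B).symm
    exact this
  have hdetM : (B.det : ℂ) ^ 2 * M.det = ∏ i, (1 + Complex.I * d i : ℂ) := by
    have := congrArg Matrix.det hdiag
    rw [Matrix.det_mul, Matrix.det_mul, Matrix.det_transpose, Matrix.det_diagonal, hdetBc] at this
    rw [← this]; ring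
  set f : (ι → ℝ) → ℂ :=
    fun x => Complex.exp (-((fun i => (x i : ℂ)) ⬝ᵥ (M *ᵥ fun i => (x i : ℂ)))) with hf
  have hfc : Continuous f := by
    simp only [hf, dotProduct, Matrix.mulVec]
    fun_prop
  have hfB : ∀ y : ι → ℝ, f (Matrix.toLin' B y) =
      ∏ i, Complex.exp (-(1 + Complex.I * d i) * (y i : ℂ) ^ 2) := by
    intro y
    have h1 : (fun i => ((Matrix.toLin' B y) i : ℂ)) = Bc *ᵥ fun i => (y i : ℂ) := by
      ext i
      simp [Matrix.mulVec, dotProduct, hBc]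
    have h2 : (Bc *ᵥ fun i => (y i : ℂ)) ⬝ᵥ (M *ᵥ (Bc *ᵥ fun i => (y i : ℂ))) =
        (fun i => (y i : ℂ)) ⬝ᵥ ((Bcᵀ * M * Bc) *ᵥ fun i => (y i : ℂ)) := by
      rw [← Matrix.mulVec_mulVec, ← Matrix.mulVec_mulVec,
        Matrix.dotProduct_mulVec _ Bcᵀ, Matrix.vecMul_transpose]
    simp only [hf]
    rw [h1, h2, hdiag, ← Complex.exp_sum]
    congr 1
    simp only [dotProduct, Matrix.mulVec_diagonal, ← Finset.sum_neg_distrib]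
    exact Finset.sum_congr rfl fun i _ => by ring
  have hmap := Real.map_matrix_volume_pi_eq_smul_volume_pi hdetB
  have hint : (|B.det|⁻¹ : ℝ) • ∫ x, f x = ∫ y, f (Matrix.toLin' B y) := by
    rw [← integral_map (μ := volume) (φ := Matrix.toLin' B) (f := f)
      (by have := (Matrix.toLin' B).continuous_of_finiteDimensional; fun_prop)
      hfc.aestronglyMeasurable, hmap, integral_smul_measure,
      ENNReal.toReal_ofReal (abs_nonneg _), abs_inv]
  have hval : ∫ y : ι → ℝ, f (Matrix.toLin' B y) =
      ∏ i, ((Real.pi : ℂ) / (1 + Complex.I * d i)) ^ (1 / 2 : ℂ) := by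
    simp only [hfB]
    rw [integral_fintype_prod_volume_eq_prod (𝕜 := ℂ)
      (f := fun i (t : ℝ) => Complex.exp (-(1 + Complex.I * d i) * (t : ℂ) ^ 2))]
    exact Finset.prod_congr rfl fun i _ => integral_gaussian_complex (by simp)
  have hne : ∀ i, (1 + Complex.I * d i : ℂ) ≠ 0 := by
    intro i h
    have := congrArg Complex.re h
    simp at this
  have hI : (∫ x, f x) = (|B.det| : ℝ) • ∏ i, ((Real.pi : ℂ) / (1 + Complex.I * d i)) ^ (1 / 2 : ℂ) := by
    rw [← hval, ← hint, smul_smul, mul_inv_cancel₀ (abs_ne_zero.2 hdetB), one_smul]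
  -- Each factor is a principal square root; squaring the integral removes any question of branches
  -- of the root of `M.det`.
  have hsq : (∏ i, ((Real.pi : ℂ) / (1 + Complex.I * d i)) ^ (1 / 2 : ℂ)) ^ 2 =
      ∏ i, ((Real.pi : ℂ) / (1 + Complex.I * d i)) := by
    rw [← Finset.prod_pow]
    refine Finset.prod_congr rfl fun i _ => ?_
    rw [← Complex.cpow_nat_mul]
    norm_num
  rw [hI, Complex.real_smul, mul_pow, hsq, Finset.prod_div_distrib, Finset.prod_const,
    ← hdetM, Finset.card_univ]
  have hp : (∏ i, (1 + Complex.I * d i : ℂ)) ≠ 0 := Finset.prod_ne_zero_iff.2 fun i _ => hne i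
  rw [← hdetM] at hp
  have hMd : M.det ≠ 0 := right_ne_zero_of_mul hp
  have hab : ((|B.det| : ℝ) : ℂ) ^ 2 = (B.det : ℂ) ^ 2 := by
    rw [← Complex.ofReal_pow, sq_abs, Complex.ofReal_pow]
  rw [hab]
  have hB0 : (B.det : ℂ) ≠ 0 := Complex.ofReal_ne_zero.2 hdetB
  field_simp

namespace PonzanoRegge
noncomputable section

/-! ### Spinors as quaternions -/

/-- Four-dimensional Euclidean space. -/
abbrev E4 : Type := EuclideanSpace ℝ (Fin 4)

/-- The quaternion with given real coordinates, as a complex matrix. -/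
def quat (x : E4) : Matrix (Fin 2) (Fin 2) ℂ :=
  !![(x 0 : ℂ) + x 1 * Complex.I, -((x 2 : ℂ) - x 3 * Complex.I);
     (x 2 : ℂ) + x 3 * Complex.I, (x 0 : ℂ) - x 1 * Complex.I]

theorem norm_sq_E4 (x : E4) : ‖x‖ ^ 2 = x 0 ^ 2 + x 1 ^ 2 + x 2 ^ 2 + x 3 ^ 2 := by
  rw [EuclideanSpace.norm_sq_eq, Fin.sum_univ_four]
  simp

theorem det_quat (x : E4) : (quat x).det = ((‖x‖ ^ 2 : ℝ) : ℂ) := by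
  rw [norm_sq_E4, Matrix.det_fin_two]
  simp only [quat, Matrix.of_apply, Matrix.cons_val', Matrix.cons_val_zero, Matrix.cons_val_one,
    Matrix.cons_val_fin_one]
  push_cast
  linear_combination (-(x 1 : ℂ) ^ 2 - (x 3 : ℂ) ^ 2) * Complex.I_sq

theorem quat_mul_star_quat (x : E4) : quat x * (quat x)ᴴ = ((‖x‖ ^ 2 : ℝ) : ℂ) • 1 := by
  rw [norm_sq_E4]
  have hI := Complex.I_sq
  ext i j
  fin_cases i <;> fin_cases j <;> simp [quat, Matrix.mul_apply, Fin.sum_univ_two] <;>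
    first
    | ring1
    | linear_combination (-(x 1 : ℂ) ^ 2 - (x 3 : ℂ) ^ 2) * hI

theorem quat_smul (r : ℝ) (x : E4) : quat (r • x) = (r : ℂ) • quat x := by
  ext i j
  fin_cases i <;> fin_cases j <;> simp [quat] <;> ring

theorem continuous_quat : Continuous quat := by
  refine continuous_matrix fun i j => ?_
  fin_cases i <;> fin_cases j <;> simp only [quat] <;> simp <;> fun_prop

theorem quat_mem_SU2 {x : E4} (hx : ‖x‖ = 1) : quat x ∈ Matrix.specialUnitaryGroup (Fin 2) ℂ := by
  rw [Matrix.mem_specialUnitaryGroup_iff, Matrix.mem_unitaryGroup_iff]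
  refine ⟨?_, by simp [det_quat, hx]⟩
  have := quat_mul_star_quat x
  simpa [hx, Matrix.star_eq_conjTranspose] using this

/-- The direction of a vector, as an element of `SU(2)`. -/
def dir (x : E4) : SU2 :=
  if h : x = 0 then 1 else ⟨quat (‖x‖⁻¹ • x), quat_mem_SU2 (by
    rw [norm_smul, norm_inv, norm_norm, inv_mul_cancel₀ (norm_ne_zero_iff.2 h)])⟩

theorem coe_dir {x : E4} (h : x ≠ 0) :
    (dir x : Matrix (Fin 2) (Fin 2) ℂ) = quat (‖x‖⁻¹ • x) := by
  simp [dir, h]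

theorem quat_eq_norm_smul_dir (x : E4) : quat x = (‖x‖ : ℂ) • (dir x : Matrix (Fin 2) (Fin 2) ℂ) := by
  by_cases h : x = 0
  · subst h
    ext i j
    fin_cases i <;> fin_cases j <;> simp [quat]
  · rw [coe_dir h, quat_smul, smul_smul, Complex.ofReal_inv, mul_inv_cancel₀ (by simpa using h),
      one_smul]

/-- The direction is continuous off the origin, where its value 1 is a convention. -/
theorem measurable_dir : Measurable dir := by
  refine measurable_of_continuousOn_compl_singleton 0 ?_
  rw [continuousOn_iff_continuous_domRestrict]
  refine Continuous.congr (f := fun x : ({0}ᶜ : Set E4) => (⟨quat (‖(x : E4)‖⁻¹ • (x : E4)),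
    quat_mem_SU2 (by
      rw [norm_smul, norm_inv, norm_norm, inv_mul_cancel₀ (norm_ne_zero_iff.2 x.2)])⟩ : SU2)) ?_ ?_
  · refine Continuous.subtype_mk (continuous_quat.comp ?_) _
    exact (continuous_subtype_val.norm.inv₀ fun x => norm_ne_zero_iff.2 x.2).smul
      continuous_subtype_val
  · intro x
    have : (x : E4) ≠ 0 := x.2
    simp [dir, this]

theorem SU2_star_mul (h : SU2) : (h : Matrix (Fin 2) (Fin 2) ℂ)ᴴ * h = 1 :=
  (Matrix.mem_unitaryGroup_iff').1 h.2.1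

theorem SU2_det (h : SU2) : (h : Matrix (Fin 2) (Fin 2) ℂ).det = 1 := h.2.2

/-- Both are the inverse of `h`, because the determinant is one. The adjugate is linear in the
entries of a 2×2 matrix, which fixes the second column of `h` by the first. -/
theorem SU2_conjTranspose (h : SU2) :
    (h : Matrix (Fin 2) (Fin 2) ℂ)ᴴ = (h : Matrix (Fin 2) (Fin 2) ℂ).adjugate := by
  have h1 : (h : Matrix (Fin 2) (Fin 2) ℂ) * (h : Matrix (Fin 2) (Fin 2) ℂ).adjugate = 1 := by
    rw [Matrix.mul_adjugate, SU2_det, one_smul]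
  calc _ = (h : Matrix (Fin 2) (Fin 2) ℂ)ᴴ * (h * (h : Matrix (Fin 2) (Fin 2) ℂ).adjugate) := by
        rw [h1, mul_one]
    _ = _ := by rw [← mul_assoc, SU2_star_mul, one_mul]

theorem SU2_apply_one_one (h : SU2) : (h : Matrix (Fin 2) (Fin 2) ℂ) 1 1 = star (h.1 0 0) := by
  have := congrFun (congrFun (SU2_conjTranspose h) 0) 0
  simpa [Matrix.adjugate_fin_two] using this.symm

theorem SU2_apply_zero_one (h : SU2) : (h : Matrix (Fin 2) (Fin 2) ℂ) 0 1 = -star (h.1 1 0) := by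
  have := congrFun (congrFun (SU2_conjTranspose h) 0) 1
  simp only [Matrix.conjTranspose_apply, Matrix.adjugate_fin_two, Matrix.of_apply, Matrix.cons_val',
    Matrix.cons_val_zero, Matrix.cons_val_one, Matrix.cons_val_fin_one] at this
  rw [this, neg_neg]

/-- The real coordinates of the first column of a matrix. -/
def columnCoords (A : Matrix (Fin 2) (Fin 2) ℂ) : E4 :=
  !₂[(A 0 0).re, (A 0 0).im, (A 1 0).re, (A 1 0).im]

/-- Quaternionic matrices form a real space stable under left multiplication by SU(2), and each is
determined by its first column. -/
theorem quat_columnCoords_mul (h : SU2) (x : E4) :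
    quat (columnCoords (h * quat x)) = h * quat x := by
  have h1 := SU2_apply_one_one h
  have h2 := SU2_apply_zero_one h
  ext i j
  fin_cases i <;> fin_cases j <;> apply Complex.ext <;>
    simp [quat, columnCoords, Matrix.mul_apply, Fin.sum_univ_two, h1, h2] <;> ring

theorem quat_columnCoords (h : SU2) : quat (columnCoords h) = h := by
  have h1 := SU2_apply_one_one h
  have h2 := SU2_apply_zero_one h
  ext i j
  fin_cases i <;> fin_cases j <;> apply Complex.ext <;>
    simp [quat, columnCoords, h1, h2]

theorem columnCoords_quat (x : E4) : columnCoords (quat x) = x := by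
  ext i
  fin_cases i <;> simp [quat, columnCoords]

theorem norm_columnCoords_mul (h : SU2) (x : E4) : ‖columnCoords (h * quat x)‖ = ‖x‖ := by
  have h1 := det_quat (columnCoords (h * quat x))
  rw [quat_columnCoords_mul, Matrix.det_mul, SU2_det, one_mul, det_quat] at h1
  have h2 := Complex.ofReal_injective h1
  exact ((sq_eq_sq₀ (norm_nonneg _) (norm_nonneg _)).1 h2).symm

/-- Left multiplication by an element of `SU(2)`, as a linear isometry. -/
def leftMul (h : SU2) : E4 ≃ₗᵢ[ℝ] E4 :=
  LinearIsometry.toLinearIsometryEquiv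
    { toFun := fun x => columnCoords (h * quat x)
      map_add' := fun x y => by
        ext i
        fin_cases i <;> simp [quat, columnCoords, Matrix.mul_apply, Fin.sum_univ_two] <;> ring
      map_smul' := fun r x => by
        ext i
        fin_cases i <;> simp [quat, columnCoords, Matrix.mul_apply, Fin.sum_univ_two] <;> ring
      norm_map' := norm_columnCoords_mul h } rfl

/-- Equivariance of the direction: it transfers rotation invariance of a radial measure to left
invariance of its angular part. -/
theorem dir_leftMul (h : SU2) {x : E4} (hx : x ≠ 0) : dir (leftMul h x) = h * dir x := by
  have hx' : leftMul h x ≠ 0 := by simpa using hx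
  apply Subtype.ext
  have e1 := quat_eq_norm_smul_dir (leftMul h x)
  have e2 := quat_eq_norm_smul_dir x
  have e3 : quat (leftMul h x) = h * quat x := quat_columnCoords_mul h x
  rw [LinearIsometryEquiv.norm_map, e3, e2, Matrix.mul_smul] at e1
  have hn : (‖x‖ : ℂ) ≠ 0 := by simpa using hx
  exact (smul_right_injective _ hn e1).symm

/-! ### Haar measure as the angular part of a Gaussian measure -/

instance : SecondCountableTopology (Matrix (Fin 2) (Fin 2) ℂ) :=
  inferInstanceAs (SecondCountableTopology (Fin 2 → Fin 2 → ℂ))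

instance : SecondCountableTopology SU2 :=
  TopologicalSpace.Subtype.secondCountableTopology _

instance : IsProbabilityMeasure haarSU2 :=
  ⟨Measure.haarMeasure_self (K₀ := (⊤ : TopologicalSpace.PositiveCompacts SU2))⟩

instance : haarSU2.IsHaarMeasure := inferInstanceAs (Measure.haarMeasure _).IsHaarMeasure

/-- The normalised Gaussian density in dimension four, weighted by a power of the norm. -/
def radialDensity (d : ℕ) (r : ℝ) : ℝ := (Real.pi ^ 2)⁻¹ * Real.exp (-r ^ 2) * r ^ d

theorem radialDensity_nonneg (d : ℕ) {r : ℝ} (hr : 0 ≤ r) : 0 ≤ radialDensity d r := by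
  unfold radialDensity; positivity

theorem continuous_radialDensity (d : ℕ) : Continuous (radialDensity d) := by
  unfold radialDensity; fun_prop

/-- The unit sphere has area 4 · π²/2 = 2π² and ∫ r^(d+3) exp(-r²) dr = Γ(d/2 + 2)/2. For d = 2J
this is exactly the factorial weight Γ(J+2) of a node. -/
theorem integral_radialDensity (d : ℕ) :
    ∫ x : E4, radialDensity d ‖x‖ = Real.Gamma (d / 2 + 2) := by
  rw [integral_fun_norm_addHaar volume (radialDensity d)]
  have hv : (volume : Measure E4).real (Metric.ball 0 1) = Real.pi ^ 2 / 2 := by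
    rw [Measure.real, EuclideanSpace.volume_ball]
    have h1 : Real.sqrt Real.pi ^ 4 = Real.pi ^ 2 := by
      rw [show (4 : ℕ) = 2 * 2 from rfl, pow_mul, Real.sq_sqrt Real.pi_pos.le]
    have h2 : Real.Gamma 3 = 2 := by
      have := Real.Gamma_nat_eq_factorial 2
      norm_num at this
      norm_num [this]
    simp only [Fintype.card_fin, h1]
    norm_num [h2]
    positivity
  have hi : ∫ y in Set.Ioi (0 : ℝ), y ^ 3 • radialDensity d y =
      (Real.pi ^ 2)⁻¹ * (1 / 2 * Real.Gamma (d / 2 + 2)) := by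
    have := integral_rpow_mul_exp_neg_rpow (p := 2) (q := d + 3) (by norm_num)
      (by have : (0 : ℝ) ≤ d := d.cast_nonneg
          linarith)
    rw [show ((d : ℝ) + 3 + 1) / 2 = d / 2 + 2 by ring] at this
    rw [← this, ← integral_const_mul]
    refine setIntegral_congr_fun measurableSet_Ioi fun y hy => ?_
    have h3 : y ^ ((d : ℝ) + 3) = y ^ (d + 3) := by
      rw [← Real.rpow_natCast]; norm_num
    simp only [radialDensity, smul_eq_mul, h3, Real.rpow_two]
    ring
  rw [hv]
  simp only [finrank_euclideanSpace, Fintype.card_fin]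
  norm_num only [Nat.add_one_sub_one, Nat.reduceSub]
  rw [hi]
  have := Real.pi_ne_zero
  simp only [nsmul_eq_mul, smul_eq_mul]
  field_simp
  norm_num

theorem integrable_radialDensity (d : ℕ) : Integrable fun x : E4 => radialDensity d ‖x‖ := by
  -- A non-integrable function has integral 0 by convention, whereas the Gamma value is positive.
  by_contra h
  have h1 := integral_undef h
  rw [integral_radialDensity] at h1
  exact (Real.Gamma_pos_of_pos (by positivity)).ne' h1

/-- The radial measures on `ℝ⁴`. -/
def radialMeasure (d : ℕ) : Measure E4 :=
  volume.withDensity fun x => ENNReal.ofReal (radialDensity d ‖x‖)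

theorem measurable_ofReal_radialDensity (d : ℕ) :
    Measurable fun x : E4 => ENNReal.ofReal (radialDensity d ‖x‖) :=
  ((continuous_radialDensity d).comp continuous_norm).measurable.ennreal_ofReal

theorem radialMeasure_univ (d : ℕ) :
    radialMeasure d Set.univ = ENNReal.ofReal (Real.Gamma (d / 2 + 2)) := by
  rw [radialMeasure, withDensity_apply _ MeasurableSet.univ, setLIntegral_univ,
    ← ofReal_integral_eq_lintegral_ofReal (integrable_radialDensity d), integral_radialDensity]
  exact Filter.Eventually.of_forall fun x => radialDensity_nonneg d (norm_nonneg _)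

instance (d : ℕ) : IsFiniteMeasure (radialMeasure d) :=
  ⟨by rw [radialMeasure_univ]; exact ENNReal.ofReal_lt_top⟩

theorem map_leftMul_radialMeasure (h : SU2) (d : ℕ) :
    (radialMeasure d).map (leftMul h) = radialMeasure d := by
  have hm : Measurable (leftMul h) := (leftMul h).continuous.measurable
  ext s hs
  rw [Measure.map_apply hm hs, radialMeasure, withDensity_apply _ (hm hs),
    withDensity_apply _ hs,
    ← (leftMul h).measurePreserving.setLIntegral_comp_preimage hs (measurable_ofReal_radialDensity d)]
  simp only [LinearIsometryEquiv.norm_map]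

/-- The angular part of a radial measure is a multiple of the Haar measure. -/
theorem map_dir_radialMeasure (d : ℕ) :
    (radialMeasure d).map dir = ENNReal.ofReal (Real.Gamma (d / 2 + 2)) • haarSU2 := by
  have hfin : IsFiniteMeasure ((radialMeasure d).map dir) := inferInstance
  have hinv : ((radialMeasure d).map dir).IsMulLeftInvariant := by
    refine ⟨fun h => ?_⟩
    have hh : Measurable fun g : SU2 => h * g := (continuous_const_mul h).measurable
    have hm : Measurable (leftMul h) := (leftMul h).continuous.measurable
    rw [Measure.map_map hh measurable_dir]
    -- Equivariance fails at the origin, which is a null set.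
    have h0 : ∀ᵐ x ∂radialMeasure d, x ≠ 0 := by
      refine (withDensity_absolutelyContinuous _ _).ae_le ?_
      exact Measure.ae_ne volume 0
    have : (fun g => h * g) ∘ dir =ᵐ[radialMeasure d] dir ∘ leftMul h := by
      filter_upwards [h0] with x hx
      exact (dir_leftMul h hx).symm
    rw [Measure.map_congr this, ← Measure.map_map measurable_dir hm, map_leftMul_radialMeasure]
  -- A left invariant finite measure is a multiple of Haar measure; the multiple is the total mass.
  have := Measure.haarMeasure_unique ((radialMeasure d).map dir)
    (⊤ : TopologicalSpace.PositiveCompacts SU2)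
  rw [this]
  congr 1
  rw [← radialMeasure_univ]
  exact (Measure.map_apply measurable_dir MeasurableSet.univ)

end
end PonzanoRegge

/-! ### Product measures and products of series. -/

theorem MeasureTheory.Measure.pi_withDensity_ofReal {ι : Type*} [Fintype ι] {α : ι → Type*}
    [∀ i, MeasurableSpace (α i)] (μ : ∀ i, Measure (α i)) [∀ i, SigmaFinite (μ i)]
    (f : ∀ i, α i → ℝ) (hf : ∀ i, Integrable (f i) (μ i)) (h0 : ∀ i x, 0 ≤ f i x) :
    Measure.pi (fun i => (μ i).withDensity fun x => ENNReal.ofReal (f i x)) =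
      (Measure.pi μ).withDensity fun x => ENNReal.ofReal (∏ i, f i (x i)) := by
  have hfin : ∀ i, IsFiniteMeasure ((μ i).withDensity fun x => ENNReal.ofReal (f i x)) :=
    fun i => isFiniteMeasure_withDensity_ofReal (hf i).2
  refine Measure.pi_eq fun s hs => ?_
  rw [withDensity_apply _ (MeasurableSet.univ_pi hs), Measure.restrict_pi_pi,
    ← ofReal_integral_eq_lintegral_ofReal
      (Integrable.fintype_prod_dep fun i => (hf i).restrict)
      (Filter.Eventually.of_forall fun x => Finset.prod_nonneg fun i _ => h0 i _),
    integral_fintype_prod_eq_prod, ENNReal.ofReal_prod_of_nonneg fun i _ => integral_nonneg (h0 i)]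
  refine Finset.prod_congr rfl fun i _ => ?_
  rw [withDensity_apply _ (hs i), ofReal_integral_eq_lintegral_ofReal (hf i).restrict
    (Filter.Eventually.of_forall (h0 i))]

theorem MeasureTheory.Measure.pi_smul_measure {ι : Type*} [Fintype ι] {α : ι → Type*}
    [∀ i, MeasurableSpace (α i)] (μ : ∀ i, Measure (α i)) [∀ i, IsFiniteMeasure (μ i)]
    (c : ι → ℝ) :
    Measure.pi (fun i => ENNReal.ofReal (c i) • μ i) =
      (∏ i, ENNReal.ofReal (c i)) • Measure.pi μ := by
  have : ∀ i, IsFiniteMeasure (ENNReal.ofReal (c i) • μ i) :=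
    fun i => Measure.smul_finite _ ENNReal.ofReal_ne_top
  refine Measure.pi_eq fun s hs => ?_
  simp [Measure.pi_pi, Finset.prod_mul_distrib]

/-- The distributive law for finite products of absolutely convergent series. -/
theorem hasSum_pi_prod {𝕜 ι : Type*} [RCLike 𝕜] [Fintype ι] (f : ι → ℕ → 𝕜) (hf : ∀ i, Summable (f i)) :
    Summable (fun s : ι → ℕ => ‖∏ i, f i (s i)‖) ∧
      HasSum (fun s : ι → ℕ => ∏ i, f i (s i)) (∏ i, ∑' n, f i n) := by
  -- Series are integrals against counting measure, and counting measure on `ι → ℕ` is a product, so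
  -- the distributive law is Fubini's theorem.
  have hc : Measure.pi (fun _ : ι => (Measure.count : Measure ℕ)) = Measure.count := by
    refine Measure.ext_of_singleton fun s => ?_
    simp
  have h1 : ∀ i, Integrable (f i) Measure.count := fun i => integrable_count_iff.2 (hf i).norm
  have h2 : Integrable (fun s : ι → ℕ => ∏ i, f i (s i)) Measure.count := by
    rw [← hc]
    exact Integrable.fintype_prod h1
  have h3 : Summable (fun s : ι → ℕ => ∏ i, f i (s i)) :=
    (integrable_count_iff.1 h2).of_norm
  refine ⟨h3.norm, ?_⟩
  have h4 : ∏ i, ∑' n, f i n = ∑' s : ι → ℕ, ∏ i, f i (s i) := by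
    have e1 : ∀ i, ∑' n, f i n = ∫ n, f i n ∂Measure.count := fun i => by
      rw [integral_countable (h1 i)]
      simp
    have e2 := integral_countable h2
    simp only [count_real_singleton, one_smul] at e2
    rw [← e2, ← hc, integral_fintype_prod_eq_prod]
    simp only [e1]
  rw [h4]
  exact h3.hasSum

theorem hasSum_mul_of_summable_norm {𝕜 α β : Type*} [RCLike 𝕜] {f : α → 𝕜} {g : β → 𝕜} {a b : 𝕜}
    (hf : Summable fun x => ‖f x‖) (hg : Summable fun x => ‖g x‖) (hfa : HasSum f a)
    (hgb : HasSum g b) : HasSum (fun p : α × β => f p.1 * g p.2) (a * b) :=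
  hfa.mul hgb (summable_mul_of_summable_norm hf hg)

/-- Kept abstract in the field and in `E` to serve twice: with the complex exponential for the sum
over spins, with the real one for its absolute bound. -/
theorem hasSum_prod_pow_div_factorial {𝕜 ι : Type*} [RCLike 𝕜] [Fintype ι] {E : 𝕜 → 𝕜}
    (hE : ∀ z : 𝕜, HasSum (fun n : ℕ => z ^ n / n.factorial) (E z)) (a b : ι → 𝕜) :
    HasSum (fun s : (ι → ℕ) × (ι → ℕ) =>
        (∏ i, a i ^ s.1 i / (s.1 i).factorial) * ∏ i, b i ^ s.2 i / (s.2 i).factorial)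
      ((∏ i, E (a i)) * ∏ i, E (b i)) := by
  have ha := hasSum_pi_prod (fun i n => a i ^ n / n.factorial) fun i => (hE (a i)).summable
  have hb := hasSum_pi_prod (fun i n => b i ^ n / n.factorial) fun i => (hE (b i)).summable
  simp only [fun z => (hE z).tsum_eq] at ha hb
  have := hasSum_mul_of_summable_norm ha.1 hb.1 ha.2 hb.2
  exact this

theorem Real.hasSum_pow_div_factorial (z : ℝ) :
    HasSum (fun n : ℕ => z ^ n / n.factorial) (Real.exp z) := by
  rw [Real.exp_eq_exp_ℝ]
  exact NormedSpace.expSeries_div_hasSum_exp z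

theorem Complex.hasSum_pow_div_factorial (z : ℂ) :
    HasSum (fun n : ℕ => z ^ n / n.factorial) (Complex.exp z) := by
  rw [Complex.exp_eq_exp_ℂ]
  exact NormedSpace.expSeries_div_hasSum_exp z

/-! ### The coherent state as a Gaussian integral. -/

namespace PonzanoRegge
noncomputable section

/-- Group averaging at several nodes as a Gaussian integral. -/
theorem integral_pi_haarSU2 {ι : Type*} [Fintype ι] (d : ι → ℕ) (f : (ι → SU2) → ℂ)
    (hf : Continuous f) :
    (∏ i, (Real.Gamma (d i / 2 + 2) : ℂ)) * ∫ g, f g ∂(Measure.pi fun _ => haarSU2) =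
      ∫ x : ι → E4, ((∏ i, radialDensity (d i) ‖x i‖ : ℝ) : ℂ) * f (fun i => dir (x i)) := by
  have h1 : Measure.pi (fun i => radialMeasure (d i)) =
      (volume : Measure (ι → E4)).withDensity
        fun x => ENNReal.ofReal (∏ i, radialDensity (d i) ‖x i‖) :=
    Measure.pi_withDensity_ofReal (fun _ => volume) (fun i (x : E4) => radialDensity (d i) ‖x‖)
      (fun i => integrable_radialDensity (d i)) fun i x => radialDensity_nonneg _ (norm_nonneg _)
  have h2 : (Measure.pi (fun i => radialMeasure (d i))).map (fun x i => dir (x i)) =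
      (∏ i, ENNReal.ofReal (Real.Gamma (d i / 2 + 2))) • Measure.pi fun _ => haarSU2 := by
    rw [Measure.pi_map_pi fun i => measurable_dir.aemeasurable]
    simp only [map_dir_radialMeasure]
    exact Measure.pi_smul_measure _ _
  have hm : Measurable fun x : ι → E4 => ENNReal.ofReal (∏ i, radialDensity (d i) ‖x i‖) := by
    refine (Continuous.measurable ?_).ennreal_ofReal
    exact continuous_finsetProd _ fun i _ =>
      (continuous_radialDensity _).comp (continuous_apply i).norm
  have h3 : ∫ g, f g ∂((Measure.pi (fun i => radialMeasure (d i))).map fun x i => dir (x i)) =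
      ∫ x : ι → E4, ((∏ i, radialDensity (d i) ‖x i‖ : ℝ) : ℂ) * f (fun i => dir (x i)) := by
    rw [integral_map (by
        refine (measurable_pi_lambda _ fun i => ?_).aemeasurable
        exact measurable_dir.comp (measurable_pi_apply i)) hf.aestronglyMeasurable, h1,
      integral_withDensity_eq_integral_toReal_smul hm
        (Filter.Eventually.of_forall fun x => ENNReal.ofReal_lt_top)]
    refine integral_congr_ae (Filter.Eventually.of_forall fun x => ?_)
    simp only
    rw [ENNReal.toReal_ofReal (Finset.prod_nonneg fun i _ => radialDensity_nonneg _ (norm_nonneg _)),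
      Complex.real_smul]
  rw [← h3, h2, integral_smul_measure, ENNReal.toReal_prod, Complex.real_smul]
  congr 1
  rw [Complex.ofReal_prod]
  refine Finset.prod_congr rfl fun i _ => ?_
  rw [ENNReal.toReal_ofReal (Real.Gamma_pos_of_pos (by positivity)).le]

end
end PonzanoRegge

namespace PonzanoRegge
noncomputable section

variable {Nt Nx : ℕ}

/-- The translation of the nodes in the space direction. -/
def spaceShift (Nt Nx : ℕ) : Node Nt Nx ≃ Node Nt Nx where
  toFun := spaceSucc
  invFun := spacePred
  left_inv n := by simp [spaceSucc, spacePred]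
  right_inv n := by simp [spaceSucc, spacePred]

/-- The translation of the nodes in the time direction. -/
def timeShift (Nt Nx : ℕ) (Nγ : ℤ) : Node Nt Nx ≃ Node Nt Nx where
  toFun := timeSucc Nγ
  invFun := timePred Nγ
  left_inv := timePred_timeSucc Nγ
  right_inv := timeSucc_timePred Nγ

theorem continuous_matElem (ξ : Fin 2 → ℂ) : Continuous (matElem ξ) := by
  have : Continuous fun g : SU2 => (g : Matrix (Fin 2) (Fin 2) ℂ) := continuous_subtype_val
  unfold matElem
  fun_prop

/-- The bilinear form of a link in quaternionic variables. -/
def linkForm (ξ : Fin 2 → ℂ) (h : SU2) (y x : E4) : ℂ :=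
  star ξ ⬝ᵥ (((quat y)ᴴ * ((h : Matrix (Fin 2) (Fin 2) ℂ) * quat x)) *ᵥ ξ)

/-- A link contributes one power of the norm at each of its ends, so a link of doubled spin n
absorbs n powers at both its nodes. -/
theorem linkForm_eq (ξ : Fin 2 → ℂ) (h : SU2) (y x : E4) :
    linkForm ξ h y x = (‖y‖ : ℂ) * ‖x‖ * matElem ξ ((dir y)⁻¹ * h * dir x) := by
  have : (((dir y)⁻¹ * h * dir x : SU2) : Matrix (Fin 2) (Fin 2) ℂ) =
      (dir y : Matrix (Fin 2) (Fin 2) ℂ)ᴴ * (h * dir x) := by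
    rw [mul_assoc]
    rfl
  rw [linkForm, matElem, this, quat_eq_norm_smul_dir y, quat_eq_norm_smul_dir x,
    Matrix.conjTranspose_smul, Matrix.mul_smul, Matrix.smul_mul, Matrix.mul_smul, smul_smul,
    Matrix.smul_mulVec, dotProduct_smul]
  simp

theorem norm_add_mul_I_le (x : E4) (i : Fin 4) (hi : i ≠ 0) :
    ‖(x 0 : ℂ) + x i * Complex.I‖ ≤ ‖x‖ := by
  rw [← sq_le_sq₀ (norm_nonneg _) (norm_nonneg _), norm_sq_E4, Complex.norm_add_mul_I,
    Real.sq_sqrt (by positivity)]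
  fin_cases i
  · simp at hi
  all_goals simp; nlinarith [sq_nonneg (x 1), sq_nonneg (x 2), sq_nonneg (x 3)]

theorem inv_sqrt_two_mul_self : (1 / (Real.sqrt 2 : ℂ)) * (1 / (Real.sqrt 2 : ℂ)) = 1 / 2 := by
  rw [div_mul_div_comm, one_mul, ← Complex.ofReal_mul, Real.mul_self_sqrt (by norm_num)]
  simp

theorem spinUp_dotProduct_mulVec (A : Matrix (Fin 2) (Fin 2) ℂ) :
    star spinUp ⬝ᵥ (A *ᵥ spinUp) = A 0 0 := by
  simp [spinUp, dotProduct, Matrix.mulVec, Fin.sum_univ_two]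

theorem spinPlus_dotProduct_mulVec (A : Matrix (Fin 2) (Fin 2) ℂ) :
    star spinPlus ⬝ᵥ (A *ᵥ spinPlus) = (A 0 0 + A 0 1 + A 1 0 + A 1 1) / 2 := by
  have h := inv_sqrt_two_mul_self
  simp only [spinPlus, dotProduct, Matrix.mulVec, Fin.sum_univ_two, Pi.star_apply,
    Matrix.cons_val_zero, Matrix.cons_val_one, Matrix.cons_val_fin_one]
  have hs : star (1 / (Real.sqrt 2 : ℂ)) = 1 / (Real.sqrt 2 : ℂ) := by
    rw [← Complex.ofReal_one, ← Complex.ofReal_div]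
    exact Complex.conj_ofReal _
  rw [hs]
  linear_combination (A 0 0 + A 0 1 + A 1 0 + A 1 1) * h

theorem norm_columnCoords (g : SU2) : ‖columnCoords g‖ = 1 := by
  have h1 := det_quat (columnCoords g)
  rw [quat_columnCoords, SU2_det] at h1
  have h2 : (1 : ℝ) = ‖columnCoords g‖ ^ 2 := by exact_mod_cast h1
  nlinarith [norm_nonneg (columnCoords g)]

/-- In unit quaternion coordinates the matrix element is x₀ + i x₁. -/
theorem norm_matElem_spinUp_le (g : SU2) : ‖matElem spinUp g‖ ≤ 1 := by
  rw [← norm_columnCoords g]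
  refine le_trans (le_of_eq ?_) (norm_add_mul_I_le (columnCoords g) 1 (by decide))
  rw [matElem, spinUp_dotProduct_mulVec]
  simp [columnCoords, Complex.re_add_im]

/-- In unit quaternion coordinates the matrix element is x₀ + i x₃. -/
theorem norm_matElem_spinPlus_le (g : SU2) : ‖matElem spinPlus g‖ ≤ 1 := by
  rw [← norm_columnCoords g]
  refine le_trans (le_of_eq ?_) (norm_add_mul_I_le (columnCoords g) 3 (by decide))
  rw [matElem, spinPlus_dotProduct_mulVec, ← quat_columnCoords g, columnCoords_quat]
  congr 1
  simp [quat]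
  ring

theorem norm_linkForm_le {ξ : Fin 2 → ℂ} (hξ : ∀ g, ‖matElem ξ g‖ ≤ 1) (h : SU2) (y x : E4) :
    ‖linkForm ξ h y x‖ ≤ ‖y‖ * ‖x‖ := by
  rw [linkForm_eq, norm_mul, norm_mul, Complex.norm_real, Complex.norm_real, norm_norm, norm_norm]
  exact mul_le_of_le_one_right (by positivity) (hξ _)

theorem continuous_linkForm_apply {ι : Type*} (ξ : Fin 2 → ℂ) (h : SU2) (m n : ι) :
    Continuous fun x : ι → E4 => linkForm ξ h (x m) (x n) := by
  have h1 : Continuous fun x : ι → E4 => quat (x m) := continuous_quat.comp (continuous_apply m)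
  have h2 : Continuous fun x : ι → E4 => quat (x n) := continuous_quat.comp (continuous_apply n)
  exact continuous_const.dotProduct
    ((h1.matrix_conjTranspose.matrix_mul (continuous_const.matrix_mul h2)).matrix_mulVec
      continuous_const)

variable [NeZero Nx]

/-- The contribution of the horizontal links to the action. -/
def horForm (h : Holonomies Nt Nx) (x : Node Nt Nx → E4) : ℂ :=
  ∑ n, linkForm spinUp (h.hor n) (x (spaceSucc n)) (x n)

/-- The contribution of the vertical links to the action. -/
def verForm (Nγ : ℤ) (h : Holonomies Nt Nx) (x : Node Nt Nx → E4) : ℂ :=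
  ∑ n, linkForm spinPlus (h.ver n) (x (timeSucc Nγ n)) (x n)

/-- The quadratic action of the Gaussian representation of the coherent state. -/
def action (Nγ : ℤ) (lam tau : ℂ) (h : Holonomies Nt Nx) (x : Node Nt Nx → E4) : ℂ :=
  ((∑ n, ‖x n‖ ^ 2 : ℝ) : ℂ) - tau * horForm h x - lam * verForm Nγ h x

/-- The Gaussian integral of the action, normalised to one at vanishing couplings. -/
def gaussianState (Nγ : ℤ) (lam tau : ℂ) (h : Holonomies Nt Nx) : ℂ :=
  ((Real.pi : ℂ) ^ 2)⁻¹ ^ Fintype.card (Node Nt Nx) *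
    ∫ x : Node Nt Nx → E4, Complex.exp (-action Nγ lam tau h x)

/-- By ‖y‖‖x‖ ≤ (‖y‖² + ‖x‖²)/2 on each link; since `e` is a permutation, every node is the source
of one link and the target of one link. -/
theorem sum_norm_linkForm_le {ξ : Fin 2 → ℂ} (hξ : ∀ g, ‖matElem ξ g‖ ≤ 1)
    (e : Node Nt Nx ≃ Node Nt Nx) (h : Node Nt Nx → SU2) (x : Node Nt Nx → E4) :
    ∑ n, ‖linkForm ξ (h n) (x (e n)) (x n)‖ ≤ ∑ n, ‖x n‖ ^ 2 := by
  have h1 : ∑ n, ‖x (e n)‖ ^ 2 = ∑ n, ‖x n‖ ^ 2 := e.sum_comp fun n => ‖x n‖ ^ 2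
  calc _ ≤ ∑ n, (‖x (e n)‖ ^ 2 + ‖x n‖ ^ 2) / 2 := by
        refine Finset.sum_le_sum fun n _ => (norm_linkForm_le hξ _ _ _).trans ?_
        nlinarith [sq_nonneg (‖x (e n)‖ - ‖x n‖)]
    _ = _ := by
        rw [← Finset.sum_div, Finset.sum_add_distrib, h1]
        ring

/-- Coercivity of the action, the origin of the condition |λ| + |τ| < 1. -/
theorem le_re_action (Nγ : ℤ) (lam tau : ℂ) (h : Holonomies Nt Nx) (x : Node Nt Nx → E4) :
    (1 - ‖lam‖ - ‖tau‖) * ∑ n, ‖x n‖ ^ 2 ≤ (action Nγ lam tau h x).re := by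
  have h1 : ‖horForm h x‖ ≤ ∑ n, ‖x n‖ ^ 2 := (norm_sum_le _ _).trans
    (sum_norm_linkForm_le norm_matElem_spinUp_le (spaceShift Nt Nx) h.hor x)
  have h2 : ‖verForm Nγ h x‖ ≤ ∑ n, ‖x n‖ ^ 2 := (norm_sum_le _ _).trans
    (sum_norm_linkForm_le norm_matElem_spinPlus_le (timeShift Nt Nx Nγ) h.ver x)
  have h3 : (tau * horForm h x).re ≤ ‖tau‖ * ∑ n, ‖x n‖ ^ 2 := by
    refine (Complex.re_le_norm _).trans ?_
    rw [norm_mul]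
    gcongr
  have h4 : (lam * verForm Nγ h x).re ≤ ‖lam‖ * ∑ n, ‖x n‖ ^ 2 := by
    refine (Complex.re_le_norm _).trans ?_
    rw [norm_mul]
    gcongr
  rw [action, Complex.sub_re, Complex.sub_re, Complex.ofReal_re]
  linarith

theorem integrable_exp_neg_mul_sum_norm_sq {ι : Type*} [Fintype ι] {c : ℝ} (hc : 0 < c) :
    Integrable fun x : ι → E4 => Real.exp (-(c * ∑ i, ‖x i‖ ^ 2)) := by
  have h1 : Integrable fun x : E4 => Real.exp (-(c * ‖x‖ ^ 2)) := by
    have := (GaussianFourier.integrable_cexp_neg_mul_sq_norm_add (V := E4) (b := c)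
      (by simpa using hc) 0 0).norm
    refine this.congr (Filter.Eventually.of_forall fun x => ?_)
    simp only [Complex.norm_exp]
    congr 1
    simp [← Complex.ofReal_pow]
  have := Integrable.fintype_prod (𝕜 := ℝ) (μ := fun _ : ι => (volume : Measure E4)) fun _ => h1
  refine this.congr (Filter.Eventually.of_forall fun x => ?_)
  simp only [← Real.exp_sum, Finset.mul_sum, Finset.sum_neg_distrib]

theorem continuous_horForm (h : Holonomies Nt Nx) : Continuous (horForm h) :=
  continuous_finsetSum _ fun _ _ =>
    continuous_linkForm_apply _ _ _ _

theorem continuous_verForm (Nγ : ℤ) (h : Holonomies Nt Nx) : Continuous (verForm Nγ h) :=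
  continuous_finsetSum _ fun _ _ =>
    continuous_linkForm_apply _ _ _ _

theorem continuous_action (Nγ : ℤ) (lam tau : ℂ) (h : Holonomies Nt Nx) :
    Continuous (action Nγ lam tau h) := by
  have h1 := continuous_horForm h
  have h2 := continuous_verForm Nγ h
  unfold action
  fun_prop

/-- The integrand of the Gaussian representation of a term of the coherent state. -/
def termIntegrand (Nγ : ℤ) (lam tau : ℂ) (h : Holonomies Nt Nx) (s : Spins Nt Nx)
    (x : Node Nt Nx → E4) : ℂ :=
  ((Real.pi : ℂ) ^ 2)⁻¹ ^ Fintype.card (Node Nt Nx) * Complex.exp (-((∑ n, ‖x n‖ ^ 2 : ℝ) : ℂ)) *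
    ((∏ n, (tau * linkForm spinUp (h.hor n) (x (spaceSucc n)) (x n)) ^ s.1 n /
        (s.1 n).factorial) *
      ∏ n, (lam * linkForm spinPlus (h.ver n) (x (timeSucc Nγ n)) (x n)) ^ s.2 n /
        (s.2 n).factorial)

/-- The factor Γ(J+2) of each node pays for replacing its Haar average by a Gaussian integral with
2J powers of the norm. These are what the four adjacent links need to become bilinear forms. -/
theorem coherentTerm_eq_integral [NeZero Nt] (Nγ : ℤ) (lam tau : ℂ) (h : Holonomies Nt Nx)
    (s : Spins Nt Nx) :
    coherentTerm Nγ (fun _ => lam) (fun _ => tau) h s =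
      ∫ x : Node Nt Nx → E4, termIntegrand Nγ lam tau h s x := by
  have hcont : Continuous fun g : Node Nt Nx → SU2 =>
      ∏ n, matElem spinUp ((g (spaceSucc n))⁻¹ * h.hor n * g n) ^ twoT s n *
        matElem spinPlus ((g (timeSucc Nγ n))⁻¹ * h.ver n * g n) ^ twoL s n := by
    refine continuous_finsetProd _ fun n _ => ?_
    refine ((continuous_matElem spinUp).comp ?_).pow _ |>.mul
      (((continuous_matElem spinPlus).comp ?_).pow _) <;> fun_prop
  set d : Node Nt Nx → ℕ := fun n =>
    s.1 n + s.2 n + s.1 (spacePred n) + s.2 (timePred Nγ n) with hd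
  have key := integral_pi_haarSU2 d _ hcont
  have hw : spinWeight Nγ (fun _ => lam) (fun _ => tau) s =
      (∏ n, lam ^ s.2 n * tau ^ s.1 n / (((s.2 n).factorial : ℂ) * ((s.1 n).factorial : ℂ))) *
        ∏ n, (Real.Gamma (d n / 2 + 2) : ℂ) := by
    rw [spinWeight, ← Finset.prod_mul_distrib]
    refine Finset.prod_congr rfl fun n _ => ?_
    simp only [twoL, twoT, spinSum, hd]
    push_cast
    rfl
  rw [coherentTerm, hw, lsState, mul_assoc, key, ← integral_const_mul]
  refine integral_congr_ae (Filter.Eventually.of_forall fun x => ?_)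
  -- The norm powers a node owes to its incoming links are moved to the nodes those links come from,
  -- so that every factor is indexed by the source of a link.
  have hT : ∏ n, (‖x n‖ : ℂ) ^ s.1 (spacePred n) = ∏ n, (‖x (spaceSucc n)‖ : ℂ) ^ s.1 n := by
    rw [← (spaceShift Nt Nx).prod_comp]
    refine Finset.prod_congr rfl fun n _ => ?_
    change (‖x (spaceSucc n)‖ : ℂ) ^ s.1 (spacePred (spaceSucc n)) = _
    rw [show spacePred (spaceSucc n) = n from (spaceShift Nt Nx).left_inv n]
  have hL : ∏ n, (‖x n‖ : ℂ) ^ s.2 (timePred Nγ n) = ∏ n, (‖x (timeSucc Nγ n)‖ : ℂ) ^ s.2 n := by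
    rw [← (timeShift Nt Nx Nγ).prod_comp]
    refine Finset.prod_congr rfl fun n _ => ?_
    change (‖x (timeSucc Nγ n)‖ : ℂ) ^ s.2 (timePred Nγ (timeSucc Nγ n)) = _
    rw [timePred_timeSucc]
  have hρ : ((∏ n, radialDensity (d n) ‖x n‖ : ℝ) : ℂ) =
      ((Real.pi : ℂ) ^ 2)⁻¹ ^ Fintype.card (Node Nt Nx) * Complex.exp (-((∑ n, ‖x n‖ ^ 2 : ℝ) : ℂ)) *
        ((∏ n, (‖x n‖ : ℂ) ^ s.1 n) * (∏ n, (‖x n‖ : ℂ) ^ s.2 n) *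
          (∏ n, (‖x (spaceSucc n)‖ : ℂ) ^ s.1 n) * ∏ n, (‖x (timeSucc Nγ n)‖ : ℂ) ^ s.2 n) := by
    rw [← hT, ← hL]
    simp only [radialDensity, Finset.prod_mul_distrib, ← Real.exp_sum, Finset.sum_neg_distrib, hd,
      pow_add, Finset.prod_const, Finset.card_univ]
    push_cast
    ring
  simp only [termIntegrand, hρ, linkForm_eq, twoT, twoL, mul_pow, Finset.prod_mul_distrib,
    Finset.prod_div_distrib]
  ring

/-- The coherent state in its domain of convergence, as a Gaussian integral. -/
theorem hasSum_coherentTerm [NeZero Nt] (Nγ : ℤ) {lam tau : ℂ} (hlt : ‖lam‖ + ‖tau‖ < 1)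
    (h : Holonomies Nt Nx) :
    HasSum (coherentTerm Nγ (fun _ => lam) (fun _ => tau) h) (gaussianState Nγ lam tau h) := by
  have hpi : ‖((Real.pi : ℂ) ^ 2)⁻¹ ^ Fintype.card (Node Nt Nx)‖ =
      (Real.pi ^ 2)⁻¹ ^ Fintype.card (Node Nt Nx) := by
    simp [abs_of_pos Real.pi_pos]
  have hcont : ∀ s, Continuous (termIntegrand Nγ lam tau h s) := by
    intro s
    unfold termIntegrand
    refine Continuous.mul (by fun_prop) (Continuous.mul ?_ ?_) <;>
    · refine continuous_finsetProd _ fun n _ => Continuous.div_const (Continuous.pow ?_ _) _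
      exact continuous_const.mul
        (continuous_linkForm_apply _ _ _ _)
  -- The dominating series for exchanging sum and integral: with absolute values, the sum over spins
  -- is again a product of exponentials.
  have hnorm : ∀ x, HasSum (fun s => ‖termIntegrand Nγ lam tau h s x‖)
      ((Real.pi ^ 2)⁻¹ ^ Fintype.card (Node Nt Nx) * Real.exp (-∑ n, ‖x n‖ ^ 2) *
        Real.exp (∑ n, ‖tau * linkForm spinUp (h.hor n) (x (spaceSucc n)) (x n)‖ +
          ∑ n, ‖lam * linkForm spinPlus (h.ver n) (x (timeSucc Nγ n)) (x n)‖)) := by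
    intro x
    have := (hasSum_prod_pow_div_factorial Real.hasSum_pow_div_factorial
      (fun n => ‖tau * linkForm spinUp (h.hor n) (x (spaceSucc n)) (x n)‖)
      (fun n => ‖lam * linkForm spinPlus (h.ver n) (x (timeSucc Nγ n)) (x n)‖)).mul_left
      ((Real.pi ^ 2)⁻¹ ^ Fintype.card (Node Nt Nx) * Real.exp (-∑ n, ‖x n‖ ^ 2))
    rw [← Real.exp_sum, ← Real.exp_sum, ← Real.exp_add] at this
    have hexp : ‖Complex.exp (-((∑ n, ‖x n‖ ^ 2 : ℝ) : ℂ))‖ = Real.exp (-∑ n, ‖x n‖ ^ 2) := by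
      rw [← Complex.ofReal_neg, Complex.norm_exp_ofReal]
    simp only [termIntegrand, norm_mul, hpi, hexp, norm_prod, norm_div, norm_pow,
      Complex.norm_natCast]
    simpa only [norm_mul] using this
  have hsum : ∀ x, HasSum (fun s => termIntegrand Nγ lam tau h s x)
      (((Real.pi : ℂ) ^ 2)⁻¹ ^ Fintype.card (Node Nt Nx) *
        Complex.exp (-action Nγ lam tau h x)) := by
    intro x
    have := (hasSum_prod_pow_div_factorial Complex.hasSum_pow_div_factorial
      (fun n => tau * linkForm spinUp (h.hor n) (x (spaceSucc n)) (x n))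
      (fun n => lam * linkForm spinPlus (h.ver n) (x (timeSucc Nγ n)) (x n))).mul_left
      (((Real.pi : ℂ) ^ 2)⁻¹ ^ Fintype.card (Node Nt Nx) *
        Complex.exp (-((∑ n, ‖x n‖ ^ 2 : ℝ) : ℂ)))
    rw [← Complex.exp_sum, ← Complex.exp_sum, mul_assoc, ← Complex.exp_add,
      ← Complex.exp_add] at this
    have he : -action Nγ lam tau h x = -((∑ n, ‖x n‖ ^ 2 : ℝ) : ℂ) +
        (∑ n, tau * linkForm spinUp (h.hor n) (x (spaceSucc n)) (x n) +
          ∑ n, lam * linkForm spinPlus (h.ver n) (x (timeSucc Nγ n)) (x n)) := by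
      rw [action, horForm, verForm, Finset.mul_sum, Finset.mul_sum]
      ring
    rw [he]
    exact this
  rw [gaussianState, ← integral_const_mul]
  rw [show coherentTerm Nγ (fun _ => lam) (fun _ => tau) h =
    fun s => ∫ x, termIntegrand Nγ lam tau h s x from
      funext fun s => coherentTerm_eq_integral Nγ lam tau h s]
  refine hasSum_integral_of_dominated_convergence
    (fun s x => ‖termIntegrand Nγ lam tau h s x‖) (fun s => (hcont s).aestronglyMeasurable)
    (fun s => Filter.Eventually.of_forall fun x => le_rfl)
    (Filter.Eventually.of_forall fun x => (hnorm x).summable) ?_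
    (Filter.Eventually.of_forall hsum)
  simp only [fun x => (hnorm x).tsum_eq]
  -- The link exponent is at most (|λ| + |τ|) ∑ ‖x‖², leaving the integrable Gaussian with this
  -- rate.
  have hc : 0 < 1 - ‖lam‖ - ‖tau‖ := by linarith
  refine ((integrable_exp_neg_mul_sum_norm_sq hc).const_mul
    ((Real.pi ^ 2)⁻¹ ^ Fintype.card (Node Nt Nx))).mono' ?_ (Filter.Eventually.of_forall fun x => ?_)
  · refine Continuous.aestronglyMeasurable (Continuous.mul (by fun_prop)
      (Real.continuous_exp.comp (Continuous.add ?_ ?_))) <;>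
    · refine continuous_finsetSum _ fun n _ => (continuous_const.mul
        (continuous_linkForm_apply _ _ _ _)).norm
  · have h1 := sum_norm_linkForm_le norm_matElem_spinUp_le (spaceShift Nt Nx) h.hor x
    have h2 := sum_norm_linkForm_le norm_matElem_spinPlus_le (timeShift Nt Nx Nγ) h.ver x
    rw [Real.norm_of_nonneg (by positivity), mul_assoc, ← Real.exp_add]
    gcongr
    simp only [norm_mul, ← Finset.mul_sum]
    have h3 := mul_le_mul_of_nonneg_left h1 (norm_nonneg tau)
    have h4 := mul_le_mul_of_nonneg_left h2 (norm_nonneg lam)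
    simp only [spaceShift, timeShift, Equiv.coe_fn_mk] at h3 h4
    linarith

end
end PonzanoRegge

/-! ### Determinants under intertwining, and flattening of coordinates. -/

/-- Two matrices intertwined by an invertible matrix have the same determinant. -/
theorem Matrix.det_eq_det_of_intertwining {m n 𝕜 : Type*} [Fintype m] [DecidableEq m] [Fintype n]
    [DecidableEq n] [Field 𝕜] (e : m ≃ n) {A : Matrix m m 𝕜} {B : Matrix n n 𝕜} {W : Matrix m n 𝕜}
    {V : Matrix n m 𝕜} {c : 𝕜} (hc : c ≠ 0) (hV : V * W = c • 1) (h : A * W = W * B) :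
    A.det = B.det := by
  -- `W` is square once its columns are relabelled along `e`, and its left inverse up to the scalar
  -- `c` makes it invertible.
  have h1 : (W.submatrix id e).det ≠ 0 := by
    have h2 : (V.submatrix e id) * (W.submatrix id e) = c • 1 := by
      have : (V * W).submatrix e e = V.submatrix e id * W.submatrix id e :=
        Matrix.submatrix_mul V W e id e Function.bijective_id
      rw [← this, hV]
      ext i j
      simp [Matrix.one_apply]
    intro h3
    have := congrArg Matrix.det h2
    rw [Matrix.det_mul, h3, mul_zero, Matrix.det_smul, Matrix.det_one, mul_one] at this
    exact pow_ne_zero _ hc this.symm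
  have h4 : A * W.submatrix id e = W.submatrix id e * B.submatrix e e := by
    have e1 : (A * W).submatrix id e = A.submatrix id id * W.submatrix id e :=
      Matrix.submatrix_mul A W id id e Function.bijective_id
    have e2 : (W * B).submatrix id e = W.submatrix id e * B.submatrix e e :=
      Matrix.submatrix_mul W B id e e e.bijective
    rw [← e2, ← h, e1, Matrix.submatrix_id_id]
  have h5 := congrArg Matrix.det h4
  rw [Matrix.det_mul, Matrix.det_mul, mul_comm] at h5
  rw [mul_left_cancel₀ h1 h5, Matrix.det_submatrix_equiv_self]

theorem MeasureTheory.measurePreserving_uncurry_pi (ι κ : Type*) [Fintype ι] [Fintype κ] :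
    MeasurePreserving (fun (x : ι → κ → ℝ) (p : ι × κ) => x p.1 p.2) volume volume := by
  have hm : Measurable (fun (x : ι → κ → ℝ) (p : ι × κ) => x p.1 p.2) := by fun_prop
  refine ⟨hm, ?_⟩
  symm
  refine Measure.pi_eq fun s hs => ?_
  rw [Measure.map_apply hm (MeasurableSet.univ_pi hs)]
  have : (fun (x : ι → κ → ℝ) (p : ι × κ) => x p.1 p.2) ⁻¹' (Set.univ.pi s) =
      Set.univ.pi fun i => Set.univ.pi fun k => s (i, k) := by
    ext x
    simp [Set.mem_pi, Prod.forall]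
  rw [this, volume_pi_pi, Fintype.prod_prod_type]
  simp only [volume_pi_pi]

/-! ### The action as a complex symmetric matrix. -/

namespace PonzanoRegge
noncomputable section

/-- The basis of quaternions. -/
def quatBasis (a : Fin 4) : Matrix (Fin 2) (Fin 2) ℂ :=
  ![1, !![Complex.I, 0; 0, -Complex.I], !![0, -1; 1, 0], !![0, Complex.I; Complex.I, 0]] a

/-- The coordinates of a matrix in the basis of quaternions. -/
def quatCoord (a : Fin 4) (G : Matrix (Fin 2) (Fin 2) ℂ) : ℂ :=
  1 / 2 * ((quatBasis a)ᴴ * G).trace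

theorem quat_eq_sum (x : E4) : quat x = ∑ a, (x a : ℂ) • quatBasis a := by
  rw [Fin.sum_univ_four]
  ext i j
  fin_cases i <;> fin_cases j <;> simp [quat, quatBasis] <;> ring

/-- The basis quaternions are orthogonal for the trace form and span all complex 2×2 matrices: the
complexification of a node variable is M₂(ℂ), with independent left and right indices. -/
theorem sum_quatCoord_smul (G : Matrix (Fin 2) (Fin 2) ℂ) :
    ∑ a, quatCoord a G • quatBasis a = G := by
  rw [Fin.sum_univ_four]
  ext i j
  fin_cases i <;> fin_cases j <;>
    simp [quatCoord, quatBasis, Matrix.trace, Matrix.mul_apply, Fin.sum_univ_two] <;>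
    ring_nf <;> simp [Complex.I_sq] <;> ring

/-- The conjugate transpose of a basis quaternion is its adjugate, which is linear in dimension two.
Without conjugation of the coefficients it is therefore the adjugate that survives complexification.
-/
theorem sum_quatCoord_smul_conjTranspose (G : Matrix (Fin 2) (Fin 2) ℂ) :
    ∑ a, quatCoord a G • (quatBasis a)ᴴ = G.adjugate := by
  rw [Fin.sum_univ_four, Matrix.adjugate_fin_two]
  ext i j
  fin_cases i <;> fin_cases j <;>
    simp [quatCoord, quatBasis, Matrix.trace, Matrix.mul_apply, Fin.sum_univ_two] <;>
    ring_nf <;> simp [Complex.I_sq] <;> ring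

theorem adjugate_quatBasis (a : Fin 4) : (quatBasis a).adjugate = (quatBasis a)ᴴ := by
  rw [Matrix.adjugate_fin_two]
  ext i j
  fin_cases a <;> fin_cases i <;> fin_cases j <;> simp [quatBasis]

theorem trace_adjugate_fin_two (A : Matrix (Fin 2) (Fin 2) ℂ) : A.adjugate.trace = A.trace := by
  rw [Matrix.adjugate_fin_two, Matrix.trace_fin_two, Matrix.trace_fin_two]
  simp [add_comm]

theorem quatCoord_add (a : Fin 4) (G G' : Matrix (Fin 2) (Fin 2) ℂ) :
    quatCoord a (G + G') = quatCoord a G + quatCoord a G' := by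
  simp [quatCoord, mul_add]

theorem quatCoord_smul (a : Fin 4) (c : ℂ) (G : Matrix (Fin 2) (Fin 2) ℂ) :
    quatCoord a (c • G) = c * quatCoord a G := by
  simp only [quatCoord, Matrix.mul_smul, Matrix.trace_smul, smul_eq_mul]
  ring

theorem quatCoord_sub (a : Fin 4) (G G' : Matrix (Fin 2) (Fin 2) ℂ) :
    quatCoord a (G - G') = quatCoord a G - quatCoord a G' := by
  simp [quatCoord, mul_sub]

/-- The matrix of the bilinear form of a link. -/
def linkMatrix (P : Matrix (Fin 2) (Fin 2) ℂ) (h : SU2) (a b : Fin 4) : ℂ :=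
  ((quatBasis a)ᴴ * ((h : Matrix (Fin 2) (Fin 2) ℂ) * quatBasis b) * P).trace

/-- On M₂(ℂ) a link acts by G ↦ hGP. The factor 2 will cancel the 1/2 from symmetrising the action.
-/
theorem sum_linkMatrix_mul_quatCoord (P : Matrix (Fin 2) (Fin 2) ℂ) (h : SU2) (a : Fin 4)
    (G : Matrix (Fin 2) (Fin 2) ℂ) :
    ∑ b, linkMatrix P h a b * quatCoord b G =
      2 * quatCoord a ((h : Matrix (Fin 2) (Fin 2) ℂ) * G * P) := by
  have : ∑ b, linkMatrix P h a b * quatCoord b G =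
      ((quatBasis a)ᴴ * ((h : Matrix (Fin 2) (Fin 2) ℂ) *
        ∑ b, quatCoord b G • quatBasis b) * P).trace := by
    simp only [linkMatrix, Matrix.mul_sum, Matrix.sum_mul, Matrix.trace_sum, Matrix.mul_smul,
      Matrix.smul_mul, Matrix.trace_smul, smul_eq_mul, mul_comm]
  rw [this, sum_quatCoord_smul, quatCoord]
  simp only [Matrix.mul_assoc]
  ring

/-- The transpose describes hopping backwards along the link: the holonomy is inverted and the
projector becomes the complementary one, its adjugate. -/
theorem sum_linkMatrix_mul_quatCoord' (P : Matrix (Fin 2) (Fin 2) ℂ) (h : SU2) (a : Fin 4)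
    (G : Matrix (Fin 2) (Fin 2) ℂ) :
    ∑ b, linkMatrix P h b a * quatCoord b G =
      2 * quatCoord a ((h : Matrix (Fin 2) (Fin 2) ℂ)ᴴ * G * P.adjugate) := by
  have : ∑ b, linkMatrix P h b a * quatCoord b G =
      ((∑ b, quatCoord b G • (quatBasis b)ᴴ) *
        ((h : Matrix (Fin 2) (Fin 2) ℂ) * quatBasis a) * P).trace := by
    simp only [linkMatrix, Matrix.sum_mul, Matrix.trace_sum,
      Matrix.smul_mul, Matrix.trace_smul, smul_eq_mul, mul_comm]
  -- Taking the adjugate inside the trace preserves it in dimension two and reverses the product,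
  -- restoring `G` and moving the star to `quatBasis a` and `h`.
  rw [this, sum_quatCoord_smul_conjTranspose, ← trace_adjugate_fin_two, Matrix.adjugate_mul_distrib,
    Matrix.adjugate_mul_distrib, Matrix.adjugate_mul_distrib, Matrix.trace_mul_comm,
    adjugate_quatBasis, ← SU2_conjTranspose, Matrix.adjugate_adjugate _ (by simp), quatCoord]
  simp [Matrix.mul_assoc]

theorem linkForm_eq_trace (ξ : Fin 2 → ℂ) (h : SU2) (y x : E4) :
    linkForm ξ h y x =
      ((quat y)ᴴ * ((h : Matrix (Fin 2) (Fin 2) ℂ) * quat x) *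
        Matrix.vecMulVec ξ (star ξ)).trace := by
  rw [linkForm, Matrix.mul_vecMulVec, Matrix.trace_vecMulVec, dotProduct_comm]

theorem linkForm_eq_sum (ξ : Fin 2 → ℂ) (h : SU2) (y x : E4) :
    linkForm ξ h y x =
      ∑ a, ∑ b, (y a : ℂ) * linkMatrix (Matrix.vecMulVec ξ (star ξ)) h a b * (x b : ℂ) := by
  rw [linkForm_eq_trace, quat_eq_sum y, quat_eq_sum x]
  simp only [linkMatrix, Matrix.conjTranspose_sum, Matrix.conjTranspose_smul, Matrix.mul_sum,
    Matrix.sum_mul, Matrix.trace_sum, Matrix.mul_smul,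
      Matrix.smul_mul, Matrix.trace_smul, smul_eq_mul]
  rw [Finset.sum_comm]
  refine Finset.sum_congr rfl fun b _ => ?_
  rw [Finset.mul_sum]
  refine Finset.sum_congr rfl fun a _ => ?_
  rw [show star (y a : ℂ) = y a from Complex.conj_ofReal _]
  ring

/-- The projector on `|↑⟩`. -/
def projUp : Matrix (Fin 2) (Fin 2) ℂ := Matrix.vecMulVec spinUp (star spinUp)

/-- The projector on `|+⟩`. -/
def projPlus : Matrix (Fin 2) (Fin 2) ℂ := Matrix.vecMulVec spinPlus (star spinPlus)

theorem projUp_eq : projUp = !![1, 0; 0, 0] := by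
  ext i j
  fin_cases i <;> fin_cases j <;> simp [projUp, Matrix.vecMulVec_apply, spinUp]

theorem projPlus_eq : projPlus = !![1 / 2, 1 / 2; 1 / 2, 1 / 2] := by
  have hs : star (1 / (Real.sqrt 2 : ℂ)) = 1 / (Real.sqrt 2 : ℂ) := by
    rw [← Complex.ofReal_one, ← Complex.ofReal_div]
    exact Complex.conj_ofReal _
  ext i j
  fin_cases i <;> fin_cases j <;>
  · simp only [projPlus, Matrix.vecMulVec_apply, spinPlus, Pi.star_apply]
    change 1 / (Real.sqrt 2 : ℂ) * star (1 / (Real.sqrt 2 : ℂ)) = 1 / 2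
    rw [hs, inv_sqrt_two_mul_self]

variable {Nt Nx : ℕ}

/-- The non-symmetrised matrix of the link terms of the action. -/
def linkTerms (Nγ : ℤ) (lam tau : ℂ) (h : Holonomies Nt Nx) :
    Matrix (Node Nt Nx × Fin 4) (Node Nt Nx × Fin 4) ℂ :=
  Matrix.of fun p q =>
    (if p.1 = spaceSucc q.1 then tau * linkMatrix projUp (h.hor q.1) p.2 q.2 else 0) +
      if p.1 = timeSucc Nγ q.1 then lam * linkMatrix projPlus (h.ver q.1) p.2 q.2 else 0

/-- The symmetric matrix of the action. -/
def actionMatrix (Nγ : ℤ) (lam tau : ℂ) (h : Holonomies Nt Nx) :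
    Matrix (Node Nt Nx × Fin 4) (Node Nt Nx × Fin 4) ℂ :=
  1 - (1 / 2 : ℂ) • (linkTerms Nγ lam tau h + (linkTerms Nγ lam tau h)ᵀ)

theorem isSymm_actionMatrix (Nγ : ℤ) (lam tau : ℂ) (h : Holonomies Nt Nx) :
    (actionMatrix Nγ lam tau h).IsSymm := by
  rw [Matrix.IsSymm, actionMatrix]
  simp [add_comm]

variable [NeZero Nx]

theorem dotProduct_linkTerms_mulVec (Nγ : ℤ) (lam tau : ℂ) (h : Holonomies Nt Nx)
    (x : Node Nt Nx → E4) :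
    (fun p : Node Nt Nx × Fin 4 => (x p.1 p.2 : ℂ)) ⬝ᵥ
        (linkTerms Nγ lam tau h *ᵥ fun p => (x p.1 p.2 : ℂ)) =
      tau * horForm h x + lam * verForm Nγ h x := by
  have e1 : ∀ (c : ℂ) (f : Node Nt Nx → Node Nt Nx) (P : Matrix (Fin 2) (Fin 2) ℂ)
      (k : Node Nt Nx → SU2),
      ∑ m, ∑ a, ∑ n, ∑ b, (x m a : ℂ) *
        ((if m = f n then c * linkMatrix P (k n) a b else 0) * (x n b : ℂ)) =
      c * ∑ n, ∑ a, ∑ b, (x (f n) a : ℂ) * linkMatrix P (k n) a b * (x n b : ℂ) := by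
    intro c f P k
    have : ∀ m a n, ∑ b, (x m a : ℂ) *
        ((if m = f n then c * linkMatrix P (k n) a b else 0) * (x n b : ℂ)) =
        if m = f n then c * ∑ b, (x m a : ℂ) * linkMatrix P (k n) a b * (x n b : ℂ) else 0 := by
      intro m a n
      split_ifs
      · rw [Finset.mul_sum]
        exact Finset.sum_congr rfl fun b _ => by ring
      · simp
    simp only [this]
    rw [Finset.sum_congr rfl fun m _ => Finset.sum_comm, Finset.sum_comm, Finset.mul_sum]
    refine Finset.sum_congr rfl fun n _ => ?_
    rw [Finset.sum_comm, Finset.mul_sum]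
    simp
  have e2 : ∀ f : Node Nt Nx × Fin 4 → ℂ, ∑ p, f p = ∑ n, ∑ a, f (n, a) :=
    fun f => Fintype.sum_prod_type f
  simp only [dotProduct, Matrix.mulVec, linkTerms, Matrix.of_apply, e2,
    Finset.mul_sum, add_mul, mul_add, Finset.sum_add_distrib]
  rw [e1, e1, horForm, verForm]
  simp only [linkForm_eq_sum]
  rfl

theorem dotProduct_actionMatrix_mulVec (Nγ : ℤ) (lam tau : ℂ) (h : Holonomies Nt Nx)
    (x : Node Nt Nx → E4) :
    (fun p : Node Nt Nx × Fin 4 => (x p.1 p.2 : ℂ)) ⬝ᵥ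
        (actionMatrix Nγ lam tau h *ᵥ fun p => (x p.1 p.2 : ℂ)) = action Nγ lam tau h x := by
  rw [actionMatrix, Matrix.sub_mulVec, dotProduct_sub, Matrix.smul_mulVec, dotProduct_smul,
    Matrix.add_mulVec, dotProduct_add, Matrix.mulVec_transpose, dotProduct_comm _ (_ ᵥ* _),
    ← Matrix.dotProduct_mulVec, dotProduct_linkTerms_mulVec, action, Matrix.one_mulVec]
  have : (fun p : Node Nt Nx × Fin 4 => (x p.1 p.2 : ℂ)) ⬝ᵥ (fun p => (x p.1 p.2 : ℂ)) =
      ((∑ n, ‖x n‖ ^ 2 : ℝ) : ℂ) := by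
    have e2 : ∀ f : Node Nt Nx × Fin 4 → ℂ, ∑ p, f p = ∑ n, ∑ a, f (n, a) :=
      fun f => Fintype.sum_prod_type f
    simp only [dotProduct, e2, Fin.sum_univ_four, norm_sq_E4, Complex.ofReal_sum]
    refine Finset.sum_congr rfl fun n _ => ?_
    push_cast
    ring
  rw [this, smul_eq_mul]
  ring

/-- The Gaussian state is a square root of the inverse of the determinant of the action. -/
theorem gaussianState_sq_mul_det (Nγ : ℤ) {lam tau : ℂ} (hlt : ‖lam‖ + ‖tau‖ < 1)
    (h : Holonomies Nt Nx) :
    gaussianState Nγ lam tau h ^ 2 * (actionMatrix Nγ lam tau h).det = 1 := by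
  let T : (Node Nt Nx → E4) → (Node Nt Nx × Fin 4 → ℝ) := fun x p => x p.1 p.2
  have hT : MeasurePreserving T volume volume := by
    have h1 := volume_preserving_pi (fun _ : Node Nt Nx =>
      EuclideanSpace.volume_preserving_symm_measurableEquiv_toLp (Fin 4))
    exact (measurePreserving_uncurry_pi (Node Nt Nx) (Fin 4)).comp h1
  let S : (Node Nt Nx × Fin 4 → ℝ) → (Node Nt Nx → E4) := fun y n => !₂[y (n, 0), y (n, 1), y (n, 2), y (n, 3)]
  have hTS : ∀ y, T (S y) = y := by
    intro y
    ext ⟨n, a⟩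
    fin_cases a <;> rfl
  have hpos : ∀ y : Node Nt Nx × Fin 4 → ℝ, y ≠ 0 →
      0 < ((fun p => (y p : ℂ)) ⬝ᵥ (actionMatrix Nγ lam tau h *ᵥ fun p => (y p : ℂ))).re := by
    intro y hy
    have h1 := dotProduct_actionMatrix_mulVec Nγ lam tau h (S y)
    have h2 : ∀ p : Node Nt Nx × Fin 4, S y p.1 p.2 = y p := fun p => congrFun (hTS y) p
    simp only [h2] at h1
    rw [h1]
    refine lt_of_lt_of_le (mul_pos (by linarith) ?_) (le_re_action Nγ lam tau h (S y))
    obtain ⟨p, hp⟩ := Function.ne_iff.1 hy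
    refine Finset.sum_pos' (fun n _ => by positivity) ⟨p.1, Finset.mem_univ _, ?_⟩
    have : S y p.1 ≠ 0 := by
      intro h0
      apply hp
      rw [← h2 p, h0]
      rfl
    positivity
  have key := sq_integral_exp_neg_quadratic_mul_det (actionMatrix Nγ lam tau h)
    (isSymm_actionMatrix Nγ lam tau h) hpos
  have hint : ∫ x : Node Nt Nx → E4, Complex.exp (-action Nγ lam tau h x) =
      ∫ y : Node Nt Nx × Fin 4 → ℝ, Complex.exp (-((fun p => (y p : ℂ)) ⬝ᵥ
        (actionMatrix Nγ lam tau h *ᵥ fun p => (y p : ℂ)))) := by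
    rw [← hT.map_eq, integral_map hT.measurable.aemeasurable]
    · refine integral_congr_ae (Filter.Eventually.of_forall fun x => ?_)
      simp only [T, dotProduct_actionMatrix_mulVec]
    · refine Continuous.aestronglyMeasurable ?_
      simp only [dotProduct, Matrix.mulVec]
      fun_prop
  -- Four real coordinates per node: the squared prefactor π⁻⁴ cancels the π⁴ of each node.
  rw [gaussianState, hint, mul_pow, mul_assoc, key, Fintype.card_prod (Node Nt Nx), Fintype.card_fin,
    ← pow_mul, mul_comm _ 2, pow_mul, ← mul_comm 4, pow_mul, ← mul_pow]
  have := Complex.ofReal_ne_zero.2 Real.pi_ne_zero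
  rw [show ((Real.pi : ℂ) ^ 2)⁻¹ ^ 2 * (Real.pi : ℂ) ^ 4 = 1 by field_simp, one_pow]

end
end PonzanoRegge

namespace PonzanoRegge
noncomputable section

variable {Nt Nx : ℕ}

/-! ### Mode decomposition of the action -/

theorem det_modeMatrix (Nt Nx : ℕ) (Nγ : ℤ) (lam tau : ℂ) (φ : ℝ) (ω k : ℕ) :
    (modeMatrix Nt Nx Nγ lam tau φ ω k).det =
      1 + lam ^ 2 + tau ^ 2 - 2 * tau * (Real.cos (2 * Real.pi * k / Nx) : ℂ)
        - 2 * lam * (Real.cos (modeAngle Nt Nx Nγ φ ω k) : ℂ)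
        + 2 * lam * tau * (Real.cos (2 * Real.pi * k / Nx) : ℂ)
            * (Real.cos (modeAngle Nt Nx Nγ φ ω k) : ℂ) := by
  set θ := modeAngle Nt Nx Nγ φ ω k with hθ
  set κ : ℝ := 2 * Real.pi * k / Nx with hκ
  have h1 : Complex.exp (Complex.I * (κ : ℂ)) + Complex.exp (-(Complex.I * (κ : ℂ))) =
      2 * (Real.cos κ : ℂ) := by
    rw [Complex.ofReal_cos, Complex.cos, mul_comm Complex.I]
    ring_nf
  have h2 : Complex.exp (Complex.I * (κ : ℂ)) * Complex.exp (-(Complex.I * (κ : ℂ))) = 1 := by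
    rw [← Complex.exp_add, add_neg_cancel, Complex.exp_zero]
  have h3 : (Real.cos θ : ℂ) ^ 2 + (Real.sin θ : ℂ) ^ 2 = 1 := by
    exact_mod_cast Real.cos_sq_add_sin_sq θ
  rw [modeMatrix, Matrix.det_fin_two]
  simp only [← hθ, ← hκ, Matrix.sub_apply, Matrix.smul_apply, smul_eq_mul, Matrix.of_apply,
    Matrix.cons_val', Matrix.cons_val_zero, Matrix.cons_val_one, Matrix.cons_val_fin_one,
    Matrix.one_apply_eq]
  rw [Matrix.one_apply_ne (by decide), Matrix.one_apply_ne (by decide)]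
  linear_combination (lam * tau * (Real.cos θ : ℂ) - tau) * h1 + tau ^ 2 * h2 + lam ^ 2 * h3 -
    lam ^ 2 * (Real.sin θ : ℂ) ^ 2 * Complex.I_sq

/-- The action on the right index of a mode with hopping phases `w` in space and `z` in time. -/
def modeBlock (lam tau w z : ℂ) : Matrix (Fin 2) (Fin 2) ℂ :=
  1 - tau • (w • projUp + w⁻¹ • projUp.adjugate) - lam • (z • projPlus + z⁻¹ • projPlus.adjugate)

/-- Invariant under w ↦ w⁻¹ and z ↦ z⁻¹ separately. The two eigenvalues of the holonomy will thus
contribute equally, and the sign conventions of the plane waves do not matter. -/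
theorem det_modeBlock (lam tau : ℂ) {w z : ℂ} (hw : w ≠ 0) (hz : z ≠ 0) :
    (modeBlock lam tau w z).det =
      1 + lam ^ 2 + tau ^ 2 - tau * (w + w⁻¹) - lam * (z + z⁻¹)
        + lam * tau * (w + w⁻¹) * (z + z⁻¹) / 2 := by
  rw [modeBlock, projUp_eq, projPlus_eq, Matrix.det_fin_two]
  simp [Matrix.adjugate_fin_two]
  field_simp
  ring

/-- The action as a nearest-neighbour operator on matrix-valued fields: parallel transport
multiplies on the left, the spinor projectors on the right, so the two structures decouple. -/
theorem actionMatrix_mulVec_quatCoord (Nγ : ℤ) (lam tau : ℂ) (h : Holonomies Nt Nx) [NeZero Nx]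
    (g : Node Nt Nx → Matrix (Fin 2) (Fin 2) ℂ) (m : Node Nt Nx) (a : Fin 4) :
    (actionMatrix Nγ lam tau h *ᵥ fun p => quatCoord p.2 (g p.1)) (m, a) =
      quatCoord a (g m
        - tau • ((h.hor (spacePred m)).1 * g (spacePred m) * projUp +
            (h.hor m).1ᴴ * g (spaceSucc m) * projUp.adjugate)
        - lam • ((h.ver (timePred Nγ m)).1 * g (timePred Nγ m) * projPlus +
            (h.ver m).1ᴴ * g (timeSucc Nγ m) * projPlus.adjugate)) := by
  have e2 : ∀ f : Node Nt Nx × Fin 4 → ℂ, ∑ p, f p = ∑ n, ∑ b, f (n, b) :=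
    fun f => Fintype.sum_prod_type f
  have e3 : ∀ n, (m = spaceSucc n) ↔ (n = spacePred m) := fun n => by
    constructor
    · rintro rfl; exact ((spaceShift Nt Nx).left_inv n).symm
    · rintro rfl; exact ((spaceShift Nt Nx).right_inv m).symm
  have e4 : ∀ n, (m = timeSucc Nγ n) ↔ (n = timePred Nγ m) := fun n => by
    constructor
    · rintro rfl; exact ((timeShift Nt Nx Nγ).left_inv n).symm
    · rintro rfl; exact ((timeShift Nt Nx Nγ).right_inv m).symm
  have e5 : (linkTerms Nγ lam tau h *ᵥ fun p => quatCoord p.2 (g p.1)) (m, a) =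
      tau * (2 * quatCoord a ((h.hor (spacePred m)).1 * g (spacePred m) * projUp)) +
      lam * (2 * quatCoord a ((h.ver (timePred Nγ m)).1 * g (timePred Nγ m) * projPlus)) := by
    simp only [← sum_linkMatrix_mul_quatCoord, Finset.mul_sum]
    simp only [Matrix.mulVec, dotProduct, e2, linkTerms, Matrix.of_apply, add_mul,
      Finset.sum_add_distrib, ite_mul, zero_mul, e3, e4]
    congr 1 <;> rw [Finset.sum_comm] <;> simp [mul_assoc]
  have e6 : ((linkTerms Nγ lam tau h)ᵀ *ᵥ fun p => quatCoord p.2 (g p.1)) (m, a) =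
      tau * (2 * quatCoord a ((h.hor m).1ᴴ * g (spaceSucc m) * projUp.adjugate)) +
      lam * (2 * quatCoord a ((h.ver m).1ᴴ * g (timeSucc Nγ m) * projPlus.adjugate)) := by
    simp only [← sum_linkMatrix_mul_quatCoord', Finset.mul_sum]
    simp only [Matrix.mulVec, dotProduct, e2, linkTerms, Matrix.transpose_apply, Matrix.of_apply,
      add_mul, Finset.sum_add_distrib, ite_mul, zero_mul]
    congr 1 <;> rw [Finset.sum_comm] <;> simp [mul_assoc]
  rw [actionMatrix, Matrix.sub_mulVec, Matrix.one_mulVec, Matrix.smul_mulVec, Matrix.add_mulVec,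
    Pi.sub_apply, Pi.smul_apply, Pi.add_apply, e5, e6]
  simp only [quatCoord_sub, quatCoord_smul, quatCoord_add, smul_eq_mul]
  ring

theorem conjTranspose_mulVec_of_mulVec_eq {h : SU2} {v v' : Fin 2 → ℂ} {w : ℂ} (hw : w ≠ 0)
    (hv : h.1 *ᵥ v = w • v') : h.1ᴴ *ᵥ v' = w⁻¹ • v := by
  have : h.1ᴴ *ᵥ (h.1 *ᵥ v) = v := by
    rw [Matrix.mulVec_mulVec, SU2_star_mul, Matrix.one_mulVec]
  rw [hv, Matrix.mulVec_smul] at this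
  rw [← this, smul_smul, inv_mul_cancel₀ hw, one_smul]

/-- A plane wave is an eigenvector of the action, up to a block acting on the right index. -/
theorem actionMatrix_mulVec_planeWave (Nγ : ℤ) (lam tau : ℂ) (h : Holonomies Nt Nx) [NeZero Nx]
    {w z : ℂ} (hw : w ≠ 0) (hz : z ≠ 0) (v : Node Nt Nx → Fin 2 → ℂ)
    (hs : ∀ m, (h.hor m).1 *ᵥ v m = w • v (spaceSucc m))
    (ht : ∀ m, (h.ver m).1 *ᵥ v m = z • v (timeSucc Nγ m)) (y : Fin 2 → ℂ)
    (m : Node Nt Nx) (a : Fin 4) :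
    (actionMatrix Nγ lam tau h *ᵥ fun p => quatCoord p.2 (Matrix.vecMulVec (v p.1) y)) (m, a) =
      quatCoord a (Matrix.vecMulVec (v m) (y ᵥ* modeBlock lam tau w z)) := by
  have h1 := hs (spacePred m)
  rw [show spaceSucc (spacePred m) = m from (spaceShift Nt Nx).right_inv m] at h1
  have h2 := conjTranspose_mulVec_of_mulVec_eq hw (hs m)
  have h3 := ht (timePred Nγ m)
  rw [timeSucc_timePred] at h3
  have h4 := conjTranspose_mulVec_of_mulVec_eq hz (ht m)
  rw [actionMatrix_mulVec_quatCoord Nγ lam tau h fun n => Matrix.vecMulVec (v n) y]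
  simp only [Matrix.mul_vecMulVec, h1, h2, h3, h4, Matrix.vecMulVec_mul, modeBlock]
  congr 1
  ext i j
  simp only [Matrix.sub_apply, Matrix.smul_apply, Matrix.add_apply, Matrix.vecMulVec_apply,
    Pi.smul_apply, smul_eq_mul, Matrix.vecMul_sub, Matrix.vecMul_smul, Matrix.vecMul_add,
    Matrix.vecMul_one, Pi.sub_apply, Pi.add_apply]
  ring

/-- The eigenvectors of an element of `SU(2)` of given class angle. -/
theorem exists_eigenvectors (H : SU2) {φ : ℝ} (hφ : (H.1 0 0).re = Real.cos φ) :
    ∃ E : Matrix (Fin 2) (Fin 2) ℂ, E.det ≠ 0 ∧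
      ∀ ε : Fin 2, H.1 *ᵥ (fun l => E l ε) =
        Complex.exp ((![1, -1] ε : ℤ) * (Complex.I * φ)) • fun l => E l ε := by
  set e : ℂ := Complex.exp (Complex.I * φ) with he
  set e' : ℂ := Complex.exp (-(Complex.I * φ)) with he'
  have hee : e * e' = 1 := by rw [he, he', ← Complex.exp_add, add_neg_cancel, Complex.exp_zero]
  have hsum : e + e' = 2 * (Real.cos φ : ℂ) := by
    rw [Complex.ofReal_cos, Complex.cos, he, he', mul_comm Complex.I]
    ring_nf
  have hstar : (starRingEnd ℂ) e = e' := by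
    rw [he, he', ← Complex.exp_conj]
    simp
  have h11 : H.1 1 1 = (starRingEnd ℂ) (H.1 0 0) := SU2_apply_one_one H
  have h01 : H.1 0 1 = -(starRingEnd ℂ) (H.1 1 0) := SU2_apply_zero_one H
  have htr : H.1 0 0 + H.1 1 1 = 2 * (Real.cos φ : ℂ) := by
    rw [h11, Complex.add_conj, hφ]
    push_cast
    ring
  -- The characteristic polynomial has trace 2 cos φ and determinant 1, hence the root exp(iφ).
  have hdet : (H.1 - e • (1 : Matrix (Fin 2) (Fin 2) ℂ)).det = 0 := by
    have := SU2_det H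
    rw [Matrix.det_fin_two] at this ⊢
    simp
    linear_combination this - e * htr + e * hsum - hee
  obtain ⟨v, hv0, hv⟩ := Matrix.exists_mulVec_eq_zero_iff.2 hdet
  have hv' : H.1 *ᵥ v = e • v := by
    rw [Matrix.sub_mulVec, Matrix.smul_mulVec, Matrix.one_mulVec, sub_eq_zero] at hv
    exact hv
  have hv0' := congrFun hv' 0
  have hv1' := congrFun hv' 1
  simp only [Matrix.mulVec, dotProduct, Fin.sum_univ_two, Pi.smul_apply, smul_eq_mul] at hv0' hv1'
  -- The second column is the quaternionic conjugate of the first, with the conjugate eigenvalue.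
  -- The determinant is |v|², so the columns are independent even when H = ±1.
  refine ⟨!![v 0, -(starRingEnd ℂ) (v 1); v 1, (starRingEnd ℂ) (v 0)], ?_, ?_⟩
  · rw [Matrix.det_fin_two]
    simp only [Matrix.of_apply, Matrix.cons_val', Matrix.cons_val_zero, Matrix.cons_val_one,
      Matrix.cons_val_fin_one]
    have : v 0 * (starRingEnd ℂ) (v 0) - -(starRingEnd ℂ) (v 1) * v 1 =
        ((Complex.normSq (v 0) + Complex.normSq (v 1) : ℝ) : ℂ) := by
      rw [Complex.mul_conj, neg_mul, mul_comm _ (v 1), Complex.mul_conj]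
      push_cast
      ring
    rw [this]
    intro h0
    have h0' : Complex.normSq (v 0) + Complex.normSq (v 1) = 0 := by exact_mod_cast h0
    have n0 := Complex.normSq_nonneg (v 0)
    have n1 := Complex.normSq_nonneg (v 1)
    apply hv0
    ext i
    fin_cases i
    · exact Complex.normSq_eq_zero.1 (le_antisymm (by simp only [Fin.zero_eta]; linarith) n0)
    · exact Complex.normSq_eq_zero.1 (le_antisymm (by simp only [Fin.mk_one]; linarith) n1)
  · have hc0 := congrArg (starRingEnd ℂ) hv0'
    have hc1 := congrArg (starRingEnd ℂ) hv1'
    rw [h01] at hc0 hv0'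
    rw [h11] at hc1 hv1'
    simp only [map_add, map_mul, map_neg, Complex.conj_conj, hstar] at hc0 hc1
    intro ε
    ext i
    fin_cases ε <;> fin_cases i <;>
      simp [Matrix.mulVec, dotProduct, Fin.sum_univ_two, ← he, ← he', h01, h11]
    · linear_combination hv0'
    · linear_combination hv1'
    · linear_combination -hc1
    · linear_combination hc0

/-! ### Plane waves on the twisted torus -/

variable [NeZero Nx]

/-- The plane wave of a mode `(ω, k)`, with a sign. -/
def planeWave (Nγ : ℤ) (φ : ℝ) (σ : ℤ) (j n : Node Nt Nx) : ℂ :=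
  Complex.exp (-(σ * (Complex.I * (modeAngle Nt Nx Nγ φ j.1.val j.2.val * n.1.val)))) *
    ZMod.stdAddChar ((σ : ZMod Nx) * (j.2 * n.2))

theorem planeWave_spaceSucc (Nγ : ℤ) (φ : ℝ) (σ : ℤ) (j n : Node Nt Nx) :
    planeWave Nγ φ σ j n =
      ZMod.stdAddChar (-((σ : ZMod Nx) * j.2)) * planeWave Nγ φ σ j (spaceSucc n) := by
  have : (σ : ZMod Nx) * (j.2 * n.2) =
      -((σ : ZMod Nx) * j.2) + (σ : ZMod Nx) * (j.2 * (n.2 + 1)) := by ring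
  simp only [planeWave, spaceSucc]
  rw [this, AddChar.map_add_eq_mul]
  ring

/-- The quantisation condition: θ is chosen so that Nt·θ + γk agrees with φ modulo 2π. -/
theorem exp_modeAngle [NeZero Nt] (Nγ : ℤ) (φ : ℝ) (σ : ℤ) (j : Node Nt Nx) :
    Complex.exp (σ * (Complex.I * φ)) =
      Complex.exp (σ * (Complex.I * (modeAngle Nt Nx Nγ φ j.1.val j.2.val * Nt))) *
        ZMod.stdAddChar ((σ : ZMod Nx) * (j.2 * (Nγ : ZMod Nx))) := by
  have h1 : ((σ : ZMod Nx) * (j.2 * (Nγ : ZMod Nx))) = ((σ * (j.2.val * Nγ) : ℤ) : ZMod Nx) := by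
    push_cast
    rw [ZMod.natCast_zmod_val]
  rw [h1, ZMod.stdAddChar_coe, ← Complex.exp_add, Complex.exp_eq_exp_iff_exists_int]
  refine ⟨-(σ * j.1.val), ?_⟩
  have hNt : (Nt : ℂ) ≠ 0 := Nat.cast_ne_zero.2 (NeZero.ne Nt)
  have hNx : (Nx : ℂ) ≠ 0 := Nat.cast_ne_zero.2 (NeZero.ne Nx)
  rw [modeAngle]
  push_cast
  field_simp
  ring

/-- On the last slice the holonomy eigenvalue exp(iσφ) must equal the phase of a full time period
together with that of the spatial shift by Nγ; this is the quantisation condition. -/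
theorem planeWave_timeSucc [NeZero Nt] (Nγ : ℤ) (φ : ℝ) (σ : ℤ) (j n : Node Nt Nx) :
    (if n.1.val + 1 = Nt then Complex.exp (σ * (Complex.I * φ)) else 1) * planeWave Nγ φ σ j n =
      Complex.exp (σ * (Complex.I * modeAngle Nt Nx Nγ φ j.1.val j.2.val)) *
        planeWave Nγ φ σ j (timeSucc Nγ n) := by
  have hn := n.1.isLt
  set θ : ℝ := modeAngle Nt Nx Nγ φ j.1.val j.2.val with hθ
  by_cases h : n.1.val + 1 < Nt
  · rw [if_neg h.ne]
    simp only [planeWave, timeSucc, h, dif_pos, ← hθ]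
    rw [one_mul, ← mul_assoc (Complex.exp _), ← Complex.exp_add]
    congr 2
    push_cast
    ring
  · have h' : n.1.val + 1 = Nt := by omega
    rw [if_pos h', exp_modeAngle Nγ φ σ j]
    simp only [planeWave, timeSucc, h, dif_neg, not_false_eq_true, ← hθ]
    have e1 : (σ : ZMod Nx) * (j.2 * (n.2 + (Nγ : ZMod Nx))) =
      (σ : ZMod Nx) * (j.2 * (Nγ : ZMod Nx)) + (σ : ZMod Nx) * (j.2 * n.2) := by ring
    have e2 : (Nt : ℂ) = n.1.val + 1 := by
      have : ((n.1.val + 1 : ℕ) : ℂ) = Nt := by rw [h']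
      rw [← this]
      push_cast
      rfl
    have e3 : Complex.exp (σ * (Complex.I * (θ * Nt))) =
        Complex.exp (σ * (Complex.I * θ)) * Complex.exp (σ * (Complex.I * (θ * n.1.val))) := by
      rw [← Complex.exp_add, e2]
      ring_nf
    have e4 : Complex.exp (σ * (Complex.I * (θ * n.1.val))) *
        Complex.exp (-(σ * (Complex.I * (θ * n.1.val)))) = 1 := by
      rw [← Complex.exp_add, add_neg_cancel, Complex.exp_zero]
    rw [e1, AddChar.map_add_eq_mul, e3]
    simp only [Nat.cast_zero, mul_zero, neg_zero, Complex.exp_zero, one_mul]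
    linear_combination (Complex.exp (σ * (Complex.I * θ)) *
      ZMod.stdAddChar ((σ : ZMod Nx) * (j.2 * (Nγ : ZMod Nx))) *
      ZMod.stdAddChar ((σ : ZMod Nx) * (j.2 * n.2))) * e4

/-- Orthogonality of the plane waves. -/
theorem sum_planeWave_mul [NeZero Nt] (Nγ : ℤ) (φ : ℝ) {σ : ℤ} (hσ : σ = 1 ∨ σ = -1)
    (j j' : Node Nt Nx) :
    ∑ n, planeWave Nγ φ (-σ) j n * planeWave Nγ φ σ j' n =
      if j = j' then (Nt * Nx : ℂ) else 0 := by
  obtain ⟨ω, k⟩ := j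
  obtain ⟨ω', k'⟩ := j'
  -- As θ depends on k, the space sum comes first and forces k = k'; the k-dependence of θ then
  -- cancels and the time sum is geometric in a root of unity.
  have hsplit : ∑ n : Node Nt Nx, planeWave Nγ φ (-σ) (ω, k) n * planeWave Nγ φ σ (ω', k') n =
      (∑ t : Fin Nt, Complex.exp (σ * (Complex.I * ((modeAngle Nt Nx Nγ φ ω.val k.val -
        modeAngle Nt Nx Nγ φ ω'.val k'.val) * t.val)))) *
      ∑ x : ZMod Nx, ZMod.stdAddChar (x * ((σ : ZMod Nx) * (k' - k))) := by
    rw [Fintype.sum_prod_type, Finset.sum_mul_sum]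
    refine Finset.sum_congr rfl fun t _ => Finset.sum_congr rfl fun x _ => ?_
    simp only [planeWave]
    have e1 : x * ((σ : ZMod Nx) * (k' - k)) =
      ((-σ : ℤ) : ZMod Nx) * (k * x) + (σ : ZMod Nx) * (k' * x) := by push_cast; ring
    rw [e1, AddChar.map_add_eq_mul, mul_mul_mul_comm, ← Complex.exp_add]
    congr 2
    push_cast
    ring
  have hunit : ∀ a : ZMod Nx, (σ : ZMod Nx) * a = 0 ↔ a = 0 := by
    intro a
    rcases hσ with rfl | rfl <;> simp
  rw [hsplit, AddChar.sum_mulShift _ (ZMod.isPrimitive_stdAddChar Nx)]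
  simp only [hunit, sub_eq_zero, Prod.mk.injEq]
  by_cases hk : k' = k
  · subst hk
    have hNt : (Nt : ℂ) ≠ 0 := Nat.cast_ne_zero.2 (NeZero.ne Nt)
    set ζ : ℂ := Complex.exp (2 * Real.pi * Complex.I / Nt) with hζ
    have hprim : IsPrimitiveRoot ζ Nt := Complex.isPrimitiveRoot_exp Nt (NeZero.ne Nt)
    have hterm : ∀ t : Fin Nt, Complex.exp (σ * (Complex.I * ((modeAngle Nt Nx Nγ φ ω.val k'.val -
        modeAngle Nt Nx Nγ φ ω'.val k'.val) * t.val))) =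
        (ζ ^ (σ * ((ω.val : ℤ) - ω'.val))) ^ t.val := by
      intro t
      rw [hζ, ← Complex.exp_int_mul, ← Complex.exp_nat_mul]
      congr 1
      rw [modeAngle, modeAngle]
      push_cast
      field_simp
      ring
    simp only [hterm, and_true, if_true]
    rw [Fin.sum_univ_eq_sum_range fun t => (ζ ^ (σ * ((ω.val : ℤ) - ω'.val))) ^ t]
    by_cases hω : ω = ω'
    · subst hω
      simp [ZMod.card]
    · rw [if_neg hω]
      have hne : ζ ^ (σ * ((ω.val : ℤ) - ω'.val)) ≠ 1 := by
        rw [Ne, hprim.zpow_eq_one_iff_dvd]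
        intro hd
        have hd' : (Nt : ℤ) ∣ (ω.val : ℤ) - ω'.val := by
          rcases hσ with rfl | rfl
          · simpa using hd
          · rw [neg_one_mul] at hd
            exact (dvd_neg).1 hd
        apply hω
        have h1 := ω.isLt
        have h2 := ω'.isLt
        have h3 := Int.eq_zero_of_abs_lt_dvd hd' (by rw [abs_lt]; omega)
        exact Fin.ext (by omega)
      have hg := mul_neg_geom_sum (ζ ^ (σ * ((ω.val : ℤ) - ω'.val))) Nt
      have hpow : (ζ ^ (σ * ((ω.val : ℤ) - ω'.val))) ^ Nt = 1 := by
        rw [← zpow_natCast, zpow_comm, zpow_natCast, hprim.pow_eq_one, one_zpow]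
      rw [hpow, sub_self] at hg
      rcases mul_eq_zero.1 hg with h | h
      · exact absurd (sub_eq_zero.1 h).symm hne
      · rw [h, zero_mul]
  · rw [if_neg hk, if_neg fun h => hk h.2.symm]
    simp

end
end PonzanoRegge

/-! ### The determinant on a flat connection and the sign of the square root. -/

namespace PonzanoRegge
noncomputable section

variable {Nt Nx : ℕ} [NeZero Nx]

/-- The product of the mode determinants. -/
def modeDet (Nt Nx : ℕ) (Nγ : ℤ) (φ : ℝ) (p : ℂ × ℂ) : ℂ :=
  ∏ ω ∈ Finset.range Nt, ∏ k ∈ Finset.range Nx, (modeMatrix Nt Nx Nγ p.1 p.2 φ ω k).det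

theorem prod_node_eq_prod_range (f : ℕ → ℕ → ℂ) :
    ∏ j : Node Nt Nx, f j.1.val j.2.val =
      ∏ ω ∈ Finset.range Nt, ∏ k ∈ Finset.range Nx, f ω k := by
  have h : ∀ g : ℕ → ℂ, ∏ k : ZMod Nx, g k.val = ∏ k ∈ Finset.range Nx, g k := by
    obtain ⟨n, rfl⟩ := Nat.exists_eq_succ_of_ne_zero (NeZero.ne Nx)
    intro g
    exact Fin.prod_univ_eq_prod_range g (n + 1)
  rw [Fintype.prod_prod_type]
  simp only [h]
  exact Fin.prod_univ_eq_prod_range (fun ω => ∏ k ∈ Finset.range Nx, f ω k) Nt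

theorem stdAddChar_add_inv {a : ZMod Nx} {k : ZMod Nx} (ha : a = k ∨ a = -k) :
    ZMod.stdAddChar a + (ZMod.stdAddChar a)⁻¹ =
      2 * (Real.cos (2 * Real.pi * k.val / Nx) : ℂ) := by
  have h1 : ZMod.stdAddChar k + (ZMod.stdAddChar k)⁻¹ =
      2 * (Real.cos (2 * Real.pi * k.val / Nx) : ℂ) := by
    have : k = ((k.val : ℤ) : ZMod Nx) := by simp
    conv_lhs => rw [this]
    rw [ZMod.stdAddChar_coe, ← Complex.exp_neg, Complex.ofReal_cos, Complex.cos]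
    push_cast
    ring_nf
  rcases ha with rfl | rfl
  · exact h1
  · rw [AddChar.map_neg_eq_inv, inv_inv, add_comm, h1]

theorem exp_add_inv_eq_cos {σ : ℤ} (hσ : σ = 1 ∨ σ = -1) (θ : ℝ) :
    Complex.exp (σ * (Complex.I * θ)) + (Complex.exp (σ * (Complex.I * θ)))⁻¹ =
      2 * (Real.cos θ : ℂ) := by
  rw [← Complex.exp_neg, Complex.ofReal_cos, Complex.cos]
  rcases hσ with rfl | rfl <;> push_cast <;> ring_nf

/-- The determinant of the action on the flat connection of class angle `φ`. -/
theorem det_actionMatrix_torusHolonomies [NeZero Nt] (Nγ : ℤ) (lam tau : ℂ) (H : SU2) {φ : ℝ}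
    (hφ : (H.1 0 0).re = Real.cos φ) :
    (actionMatrix Nγ lam tau (torusHolonomies Nt Nx H)).det =
      modeDet Nt Nx Nγ φ (lam, tau) ^ 2 := by
  obtain ⟨E, hE, hHE⟩ := exists_eigenvectors H hφ
  let σ : Fin 2 → ℤ := ![1, -1]
  have hσ : ∀ ε, σ ε = 1 ∨ σ ε = -1 := by
    intro ε
    fin_cases ε <;> simp [σ]
  let v : Node Nt Nx × Fin 2 → Node Nt Nx → Fin 2 → ℂ := fun p n =>
    planeWave Nγ φ (σ p.2) p.1 n • fun l => E l p.2
  let w : Node Nt Nx × Fin 2 → ℂ := fun p => ZMod.stdAddChar (-((σ p.2 : ZMod Nx) * p.1.2))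
  let z : Node Nt Nx × Fin 2 → ℂ := fun p =>
    Complex.exp (σ p.2 * (Complex.I * modeAngle Nt Nx Nγ φ p.1.1.val p.1.2.val))
  have hw : ∀ p, w p ≠ 0 := fun p => by
    simp only [w, ZMod.stdAddChar_apply]
    exact Circle.coe_ne_zero _
  have hz : ∀ p, z p ≠ 0 := fun p => Complex.exp_ne_zero _
  -- The columns are plane waves times an eigenvector of `H` on the left index and a basis vector on
  -- the right index. `V` is built from the opposite waves and the inverse of `E`, hence is dual to
  -- `W` up to the number of nodes.
  let W : Matrix (Node Nt Nx × Fin 4) (Fin 2 × (Node Nt Nx × Fin 2)) ℂ :=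
    Matrix.of fun q c => quatCoord q.2 (Matrix.vecMulVec (v c.2 q.1) (Pi.single c.1 1))
  let V : Matrix (Fin 2 × (Node Nt Nx × Fin 2)) (Node Nt Nx × Fin 4) ℂ :=
    Matrix.of fun c q => planeWave Nγ φ (-σ c.2.2) c.2.1 q.1 *
      ∑ l, E⁻¹ c.2.2 l * quatBasis q.2 l c.1
  let B : Matrix (Fin 2 × (Node Nt Nx × Fin 2)) (Fin 2 × (Node Nt Nx × Fin 2)) ℂ :=
    Matrix.blockDiagonal fun p => (modeBlock lam tau (w p) (z p))ᵀ
  have hVW : V * W = (Nt * Nx : ℂ) • 1 := by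
    have hcoord : ∀ (G : Matrix (Fin 2) (Fin 2) ℂ) (l β : Fin 2),
        ∑ a, quatBasis a l β * quatCoord a G = G l β := by
      intro G l β
      conv_rhs => rw [← sum_quatCoord_smul G]
      simp only [Matrix.sum_apply, Matrix.smul_apply, smul_eq_mul, mul_comm]
    have hEE : ∀ ε ε', ∑ l, E⁻¹ ε l * E l ε' = if ε = ε' then 1 else 0 := by
      intro ε ε'
      have := congrFun (congrFun (Matrix.nonsing_inv_mul E (isUnit_iff_ne_zero.2 hE)) ε) ε'
      rwa [Matrix.mul_apply, Matrix.one_apply] at this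
    ext ⟨β, j, ε⟩ ⟨β', j', ε'⟩
    have e1 : (V * W) (β, j, ε) (β', j', ε') =
        (∑ n, planeWave Nγ φ (-σ ε) j n * planeWave Nγ φ (σ ε') j' n) *
          ((∑ l, E⁻¹ ε l * E l ε') * (Pi.single β' 1 : Fin 2 → ℂ) β) := by
      have e2 : ∀ f : Node Nt Nx × Fin 4 → ℂ, ∑ p, f p = ∑ n, ∑ b, f (n, b) :=
        fun f => Fintype.sum_prod_type f
      rw [Matrix.mul_apply, e2, Finset.sum_mul]
      refine Finset.sum_congr rfl fun n _ => ?_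
      calc _ = planeWave Nγ φ (-σ ε) j n * ∑ l, E⁻¹ ε l * ∑ a, quatBasis a l β *
            quatCoord a (Matrix.vecMulVec (v (j', ε') n) (Pi.single β' 1)) := by
            simp only [V, W, Matrix.of_apply, Finset.mul_sum, Finset.sum_mul]
            rw [Finset.sum_comm]
            exact Finset.sum_congr rfl fun _ _ => Finset.sum_congr rfl fun _ _ => by ring
        _ = _ := by
            simp only [hcoord, Matrix.vecMulVec_apply, v, Pi.smul_apply, smul_eq_mul,
              Finset.mul_sum, Finset.sum_mul]
            exact Finset.sum_congr rfl fun _ _ => by ring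
    rw [e1, hEE]
    by_cases hε : ε = ε'
    · subst hε
      rw [sum_planeWave_mul Nγ φ (hσ ε)]
      by_cases hβ : β = β' <;> by_cases hj : j = j' <;>
        simp [hβ, hj]
    · simp [hε]
  have hAW : actionMatrix Nγ lam tau (torusHolonomies Nt Nx H) * W = W * B := by
    ext ⟨m, a⟩ ⟨β, p⟩
    have hs : ∀ m, ((torusHolonomies Nt Nx H).hor m).1 *ᵥ v p m = w p • v p (spaceSucc m) := by
      intro m
      simp only [v, w, torusHolonomies, smul_smul]
      rw [planeWave_spaceSucc]
      exact Matrix.one_mulVec _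
    have ht : ∀ m, ((torusHolonomies Nt Nx H).ver m).1 *ᵥ v p m =
        z p • v p (timeSucc Nγ m) := by
      intro m
      simp only [v, z, torusHolonomies, smul_smul]
      rw [← planeWave_timeSucc, Matrix.mulVec_smul]
      split_ifs with hm
      · rw [hHE, smul_smul, mul_comm]
      · rw [one_mul]
        congr 1
        exact Matrix.one_mulVec _
    have e1 := actionMatrix_mulVec_planeWave Nγ lam tau (torusHolonomies Nt Nx H) (hw p) (hz p)
      (v p) hs ht (Pi.single β 1) m a
    have e2 : (actionMatrix Nγ lam tau (torusHolonomies Nt Nx H) * W) (m, a) (β, p) =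
        (actionMatrix Nγ lam tau (torusHolonomies Nt Nx H) *ᵥ fun q =>
          quatCoord q.2 (Matrix.vecMulVec (v p q.1) (Pi.single β 1))) (m, a) := rfl
    have e3 : (W * B) (m, a) (β, p) =
        ∑ β', quatCoord a (Matrix.vecMulVec (v p m) (Pi.single β' 1)) *
          modeBlock lam tau (w p) (z p) β β' := by
      rw [Matrix.mul_apply, Fintype.sum_prod_type]
      refine Finset.sum_congr rfl fun β' _ => ?_
      rw [Finset.sum_eq_single p]
      · simp [W, B, Matrix.blockDiagonal_apply]
      · intro p' _ hp'
        simp [B, Matrix.blockDiagonal_apply, hp']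
      · simp
    rw [e2, e1, e3, Fin.sum_univ_two]
    simp only [mul_comm _ (modeBlock _ _ _ _ _ _), ← quatCoord_smul, ← quatCoord_add]
    congr 1
    ext i k
    fin_cases k <;> simp [Matrix.vecMulVec_apply] <;> ring
  have e : Node Nt Nx × Fin 4 ≃ Fin 2 × (Node Nt Nx × Fin 2) := by
    refine Fintype.equivOfCardEq ?_
    rw [Fintype.card_prod (Node Nt Nx) (Fin 4), Fintype.card_prod (Fin 2) (Node Nt Nx × Fin 2),
      Fintype.card_prod (Node Nt Nx) (Fin 2)]
    simp only [Fintype.card_fin]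
    ring
  have hc : (Nt * Nx : ℂ) ≠ 0 :=
    mul_ne_zero (Nat.cast_ne_zero.2 (NeZero.ne Nt)) (Nat.cast_ne_zero.2 (NeZero.ne Nx))
  -- The determinant is independent of the eigenvalue label `p.2`, so each mode occurs twice and the
  -- total is a square.
  have hblock : ∀ p, (modeBlock lam tau (w p) (z p))ᵀ.det =
      (modeMatrix Nt Nx Nγ lam tau φ p.1.1.val p.1.2.val).det := by
    intro p
    have h1 : w p + (w p)⁻¹ = 2 * (Real.cos (2 * Real.pi * p.1.2.val / Nx) : ℂ) := by
      refine stdAddChar_add_inv ?_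
      rcases hσ p.2 with h | h <;> simp [h]
    have h2 := exp_add_inv_eq_cos (hσ p.2) (modeAngle Nt Nx Nγ φ p.1.1.val p.1.2.val)
    rw [Matrix.det_transpose, det_modeBlock lam tau (hw p) (hz p), h1, h2, det_modeMatrix]
    ring
  rw [Matrix.det_eq_det_of_intertwining e hc hVW hAW, Matrix.det_blockDiagonal]
  simp only [hblock]
  rw [modeDet, ← prod_node_eq_prod_range fun ω k => (modeMatrix Nt Nx Nγ lam tau φ ω k).det,
    Fintype.prod_prod_type, ← Finset.prod_pow]
  exact Finset.prod_congr rfl fun j _ => by simp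

/-! ### The state in its domain of convergence -/

theorem modeDet_zero (Nt Nx : ℕ) (Nγ : ℤ) (φ : ℝ) : modeDet Nt Nx Nγ φ 0 = 1 := by
  simp [modeDet, det_modeMatrix]

theorem analyticAt_modeDet (Nt Nx : ℕ) (Nγ : ℤ) (φ : ℝ) (p : ℂ × ℂ) :
    AnalyticAt ℂ (modeDet Nt Nx Nγ φ) p := by
  unfold modeDet
  simp only [det_modeMatrix]
  refine Finset.analyticAt_fun_prod _ fun ω _ => Finset.analyticAt_fun_prod _ fun k _ => ?_
  have h1 : AnalyticAt ℂ (fun p : ℂ × ℂ => p.1) p := analyticAt_fst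
  have h2 : AnalyticAt ℂ (fun p : ℂ × ℂ => p.2) p := analyticAt_snd
  fun_prop

/-- The square is one, and without couplings the integral is real and nonnegative. -/
theorem gaussianState_zero (Nγ : ℤ) (h : Holonomies Nt Nx)
    (hdet : (actionMatrix Nγ 0 0 h).det = 1) : gaussianState Nγ 0 0 h = 1 := by
  have h1 := gaussianState_sq_mul_det Nγ (lam := 0) (tau := 0) (by simp) h
  rw [hdet, mul_one] at h1
  have h2 : gaussianState Nγ 0 0 h =
      (((Real.pi ^ 2)⁻¹ ^ Fintype.card (Node Nt Nx) *
        ∫ x : Node Nt Nx → E4, Real.exp (-∑ n, ‖x n‖ ^ 2) : ℝ) : ℂ) := by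
    rw [gaussianState, Complex.ofReal_mul, ← integral_complex_ofReal]
    simp only [action, zero_mul, sub_zero]
    push_cast
    rfl
  have h3 : 0 ≤ (Real.pi ^ 2)⁻¹ ^ Fintype.card (Node Nt Nx) *
        ∫ x : Node Nt Nx → E4, Real.exp (-∑ n, ‖x n‖ ^ 2) :=
    mul_nonneg (by positivity) (integral_nonneg fun x => (Real.exp_pos _).le)
  rw [h2] at h1 ⊢
  have h4 := (pow_eq_one_iff_of_nonneg h3 two_ne_zero).1 (by exact_mod_cast h1 :
    ((Real.pi ^ 2)⁻¹ ^ Fintype.card (Node Nt Nx) *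
        ∫ x : Node Nt Nx → E4, Real.exp (-∑ n, ‖x n‖ ^ 2)) ^ 2 = 1)
  rw [h4, Complex.ofReal_one]

theorem norm_ofReal_mul_add_le (lam tau : ℂ) {s : ℝ} (hs : s ∈ Set.Icc (0 : ℝ) 1) :
    ‖(s : ℂ) * lam‖ + ‖(s : ℂ) * tau‖ ≤ ‖lam‖ + ‖tau‖ := by
  rw [norm_mul, norm_mul, Complex.norm_real, Real.norm_of_nonneg hs.1, ← mul_add]
  exact mul_le_of_le_one_left (by positivity) hs.2

theorem continuousOn_gaussianState (Nγ : ℤ) {lam tau : ℂ} (hlt : ‖lam‖ + ‖tau‖ < 1)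
    (h : Holonomies Nt Nx) :
    ContinuousOn (fun s : ℝ => gaussianState Nγ (s * lam) (s * tau) h) (Set.Icc 0 1) := by
  have hc : 0 < 1 - ‖lam‖ - ‖tau‖ := by linarith
  have hb := integrable_exp_neg_mul_sum_norm_sq (ι := Node Nt Nx) hc
  have hint : ContinuousOn (fun s : ℝ => ∫ x : Node Nt Nx → E4,
      Complex.exp (-action Nγ (s * lam) (s * tau) h x)) (Set.Icc 0 1) := by
    refine continuousOn_of_dominated ?_ ?_ hb ?_
    · intro s _
      have h1 := continuous_action Nγ (s * lam) (s * tau) h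
      have h2 : Continuous fun x => Complex.exp (-action Nγ (s * lam) (s * tau) h x) := by fun_prop
      exact h2.aestronglyMeasurable
    · intro s hs
      refine Filter.Eventually.of_forall fun x => ?_
      rw [Complex.norm_exp, Complex.neg_re, Real.exp_le_exp, neg_le_neg_iff]
      refine le_trans ?_ (le_re_action Nγ _ _ h x)
      have h1 := norm_ofReal_mul_add_le lam tau hs
      exact mul_le_mul_of_nonneg_right (by linarith)
        (Finset.sum_nonneg fun n _ => by positivity)
    · refine Filter.Eventually.of_forall fun x => Continuous.continuousOn ?_
      unfold action
      fun_prop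
  exact continuousOn_const.mul hint

/-- The product is continuous along the segment from zero couplings and squares to one there, so it
keeps its initial value 1. -/
theorem gaussianState_mul_modeDet [NeZero Nt] (Nγ : ℤ) {lam tau : ℂ} (hlt : ‖lam‖ + ‖tau‖ < 1) (H : SU2)
    {φ : ℝ} (hφ : (H.1 0 0).re = Real.cos φ) :
    gaussianState Nγ lam tau (torusHolonomies Nt Nx H) * modeDet Nt Nx Nγ φ (lam, tau) = 1 := by
  set h := torusHolonomies Nt Nx H with hh
  set f : ℝ → ℂ := fun s => gaussianState Nγ (s * lam) (s * tau) h *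
    modeDet Nt Nx Nγ φ (s * lam, s * tau) with hf
  have hsq : Set.EqOn (f ^ 2) ((fun _ : ℝ => (1 : ℂ)) ^ 2) (Set.Icc 0 1) := by
    intro s hs
    have := gaussianState_sq_mul_det Nγ ((norm_ofReal_mul_add_le lam tau hs).trans_lt hlt) h
    rw [hh, det_actionMatrix_torusHolonomies Nγ _ _ H hφ] at this
    simp only [hf, Pi.pow_apply, one_pow, mul_pow]
    exact this
  have hcont : ContinuousOn f (Set.Icc 0 1) := by
    refine ContinuousOn.mul ?_ ?_
    · exact continuousOn_gaussianState Nγ hlt h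
    · have : Continuous (modeDet Nt Nx Nγ φ) :=
        continuous_iff_continuousAt.2 fun p => (analyticAt_modeDet Nt Nx Nγ φ p).continuousAt
      exact (this.comp (by fun_prop : Continuous fun s : ℝ => ((s : ℂ) * lam, (s : ℂ) * tau))).continuousOn
  have h0 : f 0 = 1 := by
    have hd : (actionMatrix Nγ 0 0 h).det = 1 := by
      rw [hh, det_actionMatrix_torusHolonomies Nγ _ _ H hφ]
      have := modeDet_zero Nt Nx Nγ φ
      rw [show ((0 : ℂ), (0 : ℂ)) = 0 from rfl, this, one_pow]
    simp only [hf, Complex.ofReal_zero, zero_mul]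
    rw [gaussianState_zero Nγ h hd, show ((0 : ℂ), (0 : ℂ)) = 0 from rfl, modeDet_zero, one_mul]
  have h1 : f 1 = 1 := by
    rcases isPreconnected_Icc.eq_or_eq_neg_of_sq_eq hcont continuousOn_const hsq
      (fun _ => one_ne_zero) with h2 | h2
    · exact h2 (Set.right_mem_Icc.2 zero_le_one)
    · have := h2 (Set.left_mem_Icc.2 zero_le_one)
      rw [h0, Pi.neg_apply] at this
      norm_num at this
  simpa [hf] using h1

end
end PonzanoRegge

/-! ### Zeros of analytic functions and analytic continuation. -/

/-- By the identity theorem the zeros form a discrete set, and a discrete subset of a second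
countable space is countable. Used over ℂ for the couplings and over ℝ for the class angle. -/
theorem AnalyticOnNhd.countable_zeros {𝕜 : Type*} [NontriviallyNormedField 𝕜] [ConnectedSpace 𝕜]
    [SecondCountableTopology 𝕜] {E : Type*} [NormedAddCommGroup E] [NormedSpace 𝕜 E] {f : 𝕜 → E}
    (hf : AnalyticOnNhd 𝕜 f Set.univ) {x : 𝕜} (hx : f x ≠ 0) : {z | f z = 0}.Countable := by
  have h := mem_codiscrete'.1 (hf.preimage_zero_mem_codiscrete hx)
  have hset : (f ⁻¹' {0}ᶜ)ᶜ = {z | f z = 0} := by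
    ext z
    simp
  rw [hset] at h
  exact (HereditarilyLindelofSpace.isLindelof _).countable_of_isDiscrete h.2

namespace PonzanoRegge
noncomputable section

/-! ### Analytic continuation -/

/-- If F continues 1/D, the identity FD = 1 persists on the connected domain; this excludes the
zeros of D and determines F. Conversely, the component of the origin in {D ≠ 0} is a domain that
reaches every point where D ≠ 0. -/
theorem isContinuedValue_iff {f D : ℂ × ℂ → ℂ} (hD : ∀ p, AnalyticAt ℂ D p) (hD0 : D 0 ≠ 0)
    (hf : f =ᶠ[nhds 0] fun p => (D p)⁻¹) (p : ℂ × ℂ) (z : ℂ) :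
    IsContinuedValue f p z ↔ D p ≠ 0 ∧ z = (D p)⁻¹ := by
  have hDc : Continuous D := continuous_iff_continuousAt.2 fun p => (hD p).continuousAt
  constructor
  · rintro ⟨U, -, hUc, h0, hp, F, hF, hFf, rfl⟩
    have h1 : (fun q => F q * D q) =ᶠ[nhds 0] fun _ => (1 : ℂ) := by
      filter_upwards [hFf, hf, hDc.continuousAt.eventually_ne hD0] with q h1 h2 h3
      rw [h1, h2, inv_mul_cancel₀ h3]
    have h2 := AnalyticOnNhd.eqOn_of_preconnected_of_eventuallyEq (f := fun q => F q * D q)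
      (g := fun _ => (1 : ℂ)) (fun q hq => (hF q hq).mul (hD q))
      analyticOnNhd_const hUc.isPreconnected h0 h1 hp
    have h3 : D p ≠ 0 := right_ne_zero_of_mul_eq_one h2
    exact ⟨h3, eq_inv_of_mul_eq_one_left h2⟩
  · rintro ⟨hp, rfl⟩
    set S : Set (ℂ × ℂ) := {q | D q ≠ 0} with hS
    have hSo : IsOpen S := isOpen_ne_fun hDc continuous_const
    have h0S : (0 : ℂ × ℂ) ∈ S := hD0
    refine ⟨connectedComponentIn S 0, hSo.connectedComponentIn,
      isConnected_connectedComponentIn_iff.2 h0S, mem_connectedComponentIn h0S, ?_,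
      fun q => (D q)⁻¹, fun q hq => (hD q).inv (connectedComponentIn_subset S 0 hq), hf.symm, rfl⟩
    -- On the complex line through 0 and `p` the zeros of `D` are countable, and the complement of a
    -- countable set in ℂ is path connected; so `p` is joined to 0 inside `S`.
    have hline : AnalyticOnNhd ℂ (fun z : ℂ => D (z • p)) Set.univ := by
      intro z _
      refine AnalyticAt.fun_comp (hD _) ?_
      fun_prop
    have hcount := hline.countable_zeros (x := 0) (by simpa using hD0)
    have hconn := (hcount.isPathConnected_compl_of_one_lt_rank
      (by simp [Complex.rank_real_complex])).isConnected.isPreconnected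
    have himg : IsPreconnected ((fun z : ℂ => z • p) '' {z | D (z • p) = 0}ᶜ) :=
      hconn.image _ (by fun_prop)
    have hsub : (fun z : ℂ => z • p) '' {z | D (z • p) = 0}ᶜ ⊆ S := by
      rintro _ ⟨z, hz, rfl⟩
      exact hz
    refine himg.subset_connectedComponentIn ⟨0, by simpa using hD0, by simp⟩ hsub
      ⟨1, by simpa using hp, by simp⟩

/-- Where D vanishes there is no continuation; the default value 0 agrees with the convention 0⁻¹ =
0. -/
theorem continuedValue_eq {f D : ℂ × ℂ → ℂ} (hD : ∀ p, AnalyticAt ℂ D p) (hD0 : D 0 ≠ 0)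
    (hf : f =ᶠ[nhds 0] fun p => (D p)⁻¹) (p : ℂ × ℂ) : continuedValue f p = (D p)⁻¹ := by
  unfold continuedValue
  split_ifs with h
  · exact ((isContinuedValue_iff hD hD0 hf p _).1 h.choose_spec).2
  · by_contra h1
    refine h ⟨_, (isContinuedValue_iff hD hD0 hf p _).2 ⟨?_, rfl⟩⟩
    intro h2
    rw [h2, inv_zero] at h1
    exact h1 rfl

variable {Nt Nx : ℕ} [NeZero Nt] [NeZero Nx]

theorem coherentSeries_torusHolonomies (Nγ : ℤ) {lam tau : ℂ} (hlt : ‖lam‖ + ‖tau‖ < 1) (H : SU2)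
    {φ : ℝ} (hφ : (H.1 0 0).re = Real.cos φ) :
    coherentSeries Nγ (fun _ => lam) (fun _ => tau) (torusHolonomies Nt Nx H) =
      (modeDet Nt Nx Nγ φ (lam, tau))⁻¹ :=
  (hasSum_coherentTerm Nγ hlt _).tsum_eq.trans
    (eq_inv_of_mul_eq_one_left (gaussianState_mul_modeDet Nγ hlt H hφ))

theorem homogeneousSeries_eventuallyEq (Nγ : ℤ) (H : SU2) {φ : ℝ}
    (hφ : (H.1 0 0).re = Real.cos φ) :
    homogeneousSeries Nγ (torusHolonomies Nt Nx H) =ᶠ[nhds 0]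
      fun p => (modeDet Nt Nx Nγ φ p)⁻¹ := by
  have hc : Continuous fun p : ℂ × ℂ => ‖p.1‖ + ‖p.2‖ := by fun_prop
  have h : ∀ᶠ p : ℂ × ℂ in nhds 0, ‖p.1‖ + ‖p.2‖ < 1 :=
    hc.continuousAt.eventually_lt continuousAt_const (by simp)
  filter_upwards [h] with p hp
  exact coherentSeries_torusHolonomies Nγ hp H hφ

theorem modeDet_zero_ne_zero (Nt Nx : ℕ) (Nγ : ℤ) (φ : ℝ) : modeDet Nt Nx Nγ φ 0 ≠ 0 := by
  rw [modeDet_zero]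
  exact one_ne_zero

/-- The boundary state on the flat connection of class angle `φ`. -/
theorem boundaryState_torusHolonomies (Nγ : ℤ) (lam tau : ℂ) (H : SU2) {φ : ℝ}
    (hφ : (H.1 0 0).re = Real.cos φ) :
    boundaryState Nγ lam tau (torusHolonomies Nt Nx H) = (modeDet Nt Nx Nγ φ (lam, tau))⁻¹ :=
  continuedValue_eq (analyticAt_modeDet Nt Nx Nγ φ) (modeDet_zero_ne_zero Nt Nx Nγ φ)
    (homogeneousSeries_eventuallyEq Nγ H hφ) _

theorem existsUnique_isContinuedValue (Nγ : ℤ) {lam tau : ℂ} (H : SU2) {φ : ℝ}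
    (hφ : (H.1 0 0).re = Real.cos φ) (h : modeDet Nt Nx Nγ φ (lam, tau) ≠ 0) :
    ∃! z, IsContinuedValue (homogeneousSeries Nγ (torusHolonomies Nt Nx H)) (lam, tau) z := by
  have := isContinuedValue_iff (analyticAt_modeDet Nt Nx Nγ φ) (modeDet_zero_ne_zero Nt Nx Nγ φ)
    (homogeneousSeries_eventuallyEq Nγ H hφ) (lam, tau)
  exact ⟨_, (this _).2 ⟨h, rfl⟩, fun z hz => ((this z).1 hz).2⟩

/-- The diagonal element of `SU(2)` of class angle `φ`. -/
theorem exists_SU2_re_eq_cos (φ : ℝ) : ∃ H : SU2, (H.1 0 0).re = Real.cos φ := by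
  refine ⟨⟨quat !₂[Real.cos φ, Real.sin φ, 0, 0], quat_mem_SU2 ?_⟩, by simp [quat, Complex.cos_ofReal_re]⟩
  rw [← sq_eq_sq₀ (norm_nonneg _) zero_le_one, norm_sq_E4]
  simp

/-- The product of the mode determinants depends on the class angle through its cosine. -/
theorem modeDet_congr (Nγ : ℤ) {φ φ' : ℝ} (h : Real.cos φ = Real.cos φ') (p : ℂ × ℂ) :
    (modeDet Nt Nx Nγ φ p)⁻¹ = (modeDet Nt Nx Nγ φ' p)⁻¹ := by
  -- Both sides are the boundary state at one and the same `H`, whose class angle may be taken to be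
  -- either `φ` or `φ'`.
  obtain ⟨H, hH⟩ := exists_SU2_re_eq_cos φ
  rw [← boundaryState_torusHolonomies Nγ p.1 p.2 H hH,
    ← boundaryState_torusHolonomies Nγ p.1 p.2 H (hH.trans h)]

-- The mode matrix is 1 - (τU + λV) with U and V unitary, hence invertible by the Neumann series
-- when |λ| + |τ| < 1.
open scoped Matrix.Norms.L2Operator in
theorem det_modeMatrix_ne_zero (Nt Nx : ℕ) (Nγ : ℤ) {lam tau : ℂ} (hlt : ‖lam‖ + ‖tau‖ < 1) (φ : ℝ)
    (ω k : ℕ) : (modeMatrix Nt Nx Nγ lam tau φ ω k).det ≠ 0 := by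
  have hnorm : ∀ A : Matrix (Fin 2) (Fin 2) ℂ, star A * A = 1 → ‖A‖ ≤ 1 := by
    intro A hA
    exact CStarRing.norm_of_mem_unitary (Matrix.mem_unitaryGroup_iff'.2 hA) |>.le
  have hU : ∀ κ : ℝ, ‖(!![Complex.exp (Complex.I * (κ : ℂ)), 0;
      0, Complex.exp (-(Complex.I * (κ : ℂ)))] : Matrix (Fin 2) (Fin 2) ℂ)‖ ≤ 1 := by
    intro κ
    refine hnorm _ ?_
    ext i j
    fin_cases i <;> fin_cases j <;>
      simp [Matrix.mul_apply, Fin.sum_univ_two, ← Complex.exp_conj, ← Complex.exp_add]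
  have hV : ∀ θ : ℝ, ‖(!![(Real.cos θ : ℂ), Complex.I * (Real.sin θ : ℂ);
      Complex.I * (Real.sin θ : ℂ), (Real.cos θ : ℂ)] : Matrix (Fin 2) (Fin 2) ℂ)‖ ≤ 1 := by
    intro θ
    have h3 : (Real.cos θ : ℂ) ^ 2 + (Real.sin θ : ℂ) ^ 2 = 1 := by
      exact_mod_cast Real.cos_sq_add_sin_sq θ
    refine hnorm _ ?_
    ext i j
    fin_cases i <;> fin_cases j <;>
      simp only [Matrix.mul_apply, Fin.sum_univ_two, Matrix.star_apply] <;>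
      simp [-Complex.ofReal_cos, -Complex.ofReal_sin, Complex.conj_ofReal] <;>
      first
      | ring1
      | linear_combination h3 - (Real.sin θ : ℂ) ^ 2 * Complex.I_sq
  have h := isUnit_one_sub_of_norm_lt_one (x := tau • (!![Complex.exp (Complex.I * (2 * Real.pi * k / Nx : ℝ)), 0;
               0, Complex.exp (-(Complex.I * (2 * Real.pi * k / Nx : ℝ)))] : Matrix (Fin 2) (Fin 2) ℂ)
    + lam • !![(Real.cos (modeAngle Nt Nx Nγ φ ω k) : ℂ),
                 Complex.I * (Real.sin (modeAngle Nt Nx Nγ φ ω k) : ℂ);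
               Complex.I * (Real.sin (modeAngle Nt Nx Nγ φ ω k) : ℂ),
                 (Real.cos (modeAngle Nt Nx Nγ φ ω k) : ℂ)]) ?_
  · rw [← sub_sub] at h
    exact ((Matrix.isUnit_iff_isUnit_det _).1 h).ne_zero
  · refine (norm_add_le _ _).trans_lt ?_
    rw [norm_smul, norm_smul]
    have h1 := mul_le_of_le_one_right (norm_nonneg tau) (hU (2 * Real.pi * k / Nx))
    have h2 := mul_le_of_le_one_right (norm_nonneg lam) (hV (modeAngle Nt Nx Nγ φ ω k))
    linarith

end
end PonzanoRegge

/-- Integration of a radial function. -/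
theorem MeasureTheory.lintegral_fun_norm_addHaar {E : Type*} [NormedAddCommGroup E]
    [NormedSpace ℝ E] [MeasurableSpace E] [BorelSpace E] [FiniteDimensional ℝ E] [Nontrivial E]
    (μ : Measure E) [μ.IsAddHaarMeasure] {f : ℝ → ENNReal} (hf : Measurable f) :
    ∫⁻ x, f ‖x‖ ∂μ = Module.finrank ℝ E * μ (Metric.ball 0 1) *
      ∫⁻ y in Set.Ioi (0 : ℝ), ENNReal.ofReal (y ^ (Module.finrank ℝ E - 1)) * f y := by
  have hfs : Measurable fun y : Set.Ioi (0 : ℝ) => f y := hf.comp measurable_subtype_coe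
  calc ∫⁻ x, f ‖x‖ ∂μ = ∫⁻ x : ({(0 : E)}ᶜ : Set E), f ‖x.1‖ ∂(μ.comap (↑)) := by
        rw [lintegral_subtype_comap (measurableSet_singleton _).compl fun x => f ‖x‖,
          restrict_compl_singleton]
    _ = ∫⁻ x, f x.2 ∂(μ.toSphere.prod (Measure.volumeIoiPow (Module.finrank ℝ E - 1))) := by
        simpa using μ.measurePreserving_homeomorphUnitSphereProd.lintegral_comp_emb
          (Homeomorph.measurableEmbedding _) (f ∘ Subtype.val ∘ Prod.snd)
    _ = Module.finrank ℝ E * μ (Metric.ball 0 1) *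
        ∫⁻ y : Set.Ioi (0 : ℝ), f y ∂(Measure.volumeIoiPow (Module.finrank ℝ E - 1)) := by
        have hm : Measurable fun x : Metric.sphere (0 : E) 1 × Set.Ioi (0 : ℝ) => f x.2 :=
          hfs.comp measurable_snd
        rw [lintegral_prod _ hm.aemeasurable]
        simp [lintegral_const, mul_comm]
    _ = _ := by
        congr 1
        rw [Measure.volumeIoiPow, lintegral_withDensity_eq_lintegral_mul _ (by fun_prop) hfs]
        exact lintegral_subtype_comap measurableSet_Ioi
          fun y => ENNReal.ofReal (y ^ (Module.finrank ℝ E - 1)) * f y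

namespace PonzanoRegge
noncomputable section

/-! ### The Weyl integration formula -/

theorem lintegral_E4_eq {k : ℝ × ℝ → ENNReal} (hk : Measurable k) :
    ∫⁻ x : E4, k (x 0, Real.sqrt (x 1 ^ 2 + x 2 ^ 2 + x 3 ^ 2)) =
      ∫⁻ t : ℝ, ∫⁻ y : EuclideanSpace ℝ (Fin 3), k (t, ‖y‖) := by
  have h1 := EuclideanSpace.volume_preserving_symm_measurableEquiv_toLp (Fin 4)
  have h2 := volume_preserving_piFinSuccAbove (fun _ : Fin 4 => ℝ) 0
  have h3 := (MeasurePreserving.id (volume : Measure ℝ)).prod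
    (PiLp.volume_preserving_toLp (Fin 3))
  have h := (h3.comp h2).comp h1
  have hm : Measurable fun p : ℝ × EuclideanSpace ℝ (Fin 3) => k (p.1, ‖p.2‖) :=
    hk.comp (by fun_prop)
  rw [← lintegral_prod _ hm.aemeasurable]
  have e := h.lintegral_comp hm
  refine Eq.trans (lintegral_congr fun x => ?_) e
  congr 2
  rw [EuclideanSpace.norm_eq, Fin.sum_univ_three]
  simp only [Real.norm_eq_abs, sq_abs]
  rfl

/-- For d = 0 the mass is Γ(2) = 1: Haar measure is the law of the direction of a Gaussian vector.
-/
theorem haarSU2_eq_map : haarSU2 = (radialMeasure 0).map dir := by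
  rw [map_dir_radialMeasure]
  simp

theorem measurable_re_apply_zero_zero : Measurable fun H : SU2 => (H.1 0 0).re := by
  have h : Continuous fun H : SU2 => (H.1 : Matrix (Fin 2) (Fin 2) ℂ) := continuous_subtype_val
  exact (Complex.continuous_re.comp (h.matrix_elem 0 0)).measurable

/-- The cosine of the class angle is x₀/‖x‖, which depends only on x₀ and the norm of the other
three coordinates. -/
theorem lintegral_haarSU2_eq {F : ℝ → ENNReal} (hF : Measurable F) :
    ∫⁻ H, F (H.1 0 0).re ∂haarSU2 =
      ∫⁻ t : ℝ, ∫⁻ y : EuclideanSpace ℝ (Fin 3),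
        ENNReal.ofReal ((Real.pi ^ 2)⁻¹ * Real.exp (-(t ^ 2 + ‖y‖ ^ 2))) *
          F (t / Real.sqrt (t ^ 2 + ‖y‖ ^ 2)) := by
  have hk : Measurable fun p : ℝ × ℝ =>
      ENNReal.ofReal ((Real.pi ^ 2)⁻¹ * Real.exp (-(p.1 ^ 2 + p.2 ^ 2))) *
          F (p.1 / Real.sqrt (p.1 ^ 2 + p.2 ^ 2)) := by
    refine Measurable.mul (by fun_prop) (hF.comp ?_)
    exact measurable_fst.div (by fun_prop)
  have h1 : Measurable fun H : SU2 => F (H.1 0 0).re := hF.comp measurable_re_apply_zero_zero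
  have h2 : Measurable fun x : E4 => F ((dir x).1 0 0).re := h1.comp measurable_dir
  rw [← lintegral_E4_eq hk, haarSU2_eq_map, lintegral_map h1 measurable_dir, radialMeasure,
    lintegral_withDensity_eq_lintegral_mul _ (measurable_ofReal_radialDensity 0) h2]
  refine lintegral_congr_ae ?_
  filter_upwards [Measure.ae_ne volume (0 : E4)] with x hx
  have h1 : x 0 ^ 2 + Real.sqrt (x 1 ^ 2 + x 2 ^ 2 + x 3 ^ 2) ^ 2 = ‖x‖ ^ 2 := by
    rw [Real.sq_sqrt (by positivity), norm_sq_E4]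
    ring
  have h2 : ((dir x).1 0 0).re = x 0 / ‖x‖ := by
    rw [coe_dir hx, quat_smul]
    have h0 : ‖x‖ ≠ 0 := norm_ne_zero_iff.2 hx
    simp [quat, div_eq_inv_mul]
    left
    field_simp
  simp only [Pi.mul_apply, h1, h2, Real.sqrt_sq (norm_nonneg x), radialDensity, pow_zero, mul_one]

theorem lintegral_two_mul_pow_three_mul_exp :
    ∫⁻ ρ in Set.Ioi (0 : ℝ), ENNReal.ofReal (2 * ρ ^ 3 * Real.exp (-ρ ^ 2)) = 1 := by
  have h1 : ∫ ρ in Set.Ioi (0 : ℝ), 2 * ρ ^ 3 * Real.exp (-ρ ^ 2) = 1 := by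
    have := integral_rpow_mul_exp_neg_rpow (p := 2) (q := 3) (by norm_num) (by norm_num)
    rw [show ((3 : ℝ) + 1) / 2 = 2 by norm_num, Real.Gamma_two] at this
    have h2 : ∫ ρ in Set.Ioi (0 : ℝ), 2 * ρ ^ 3 * Real.exp (-ρ ^ 2) =
        2 * ∫ ρ in Set.Ioi (0 : ℝ), ρ ^ (3 : ℝ) * Real.exp (-ρ ^ (2 : ℝ)) := by
      rw [← integral_const_mul]
      refine setIntegral_congr_fun measurableSet_Ioi fun ρ _ => ?_
      have h3 : ρ ^ (3 : ℝ) = ρ ^ 3 := by exact_mod_cast Real.rpow_natCast ρ 3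
      simp only [h3, Real.rpow_two]
      ring
    rw [h2, this]
    norm_num
  rw [← ofReal_integral_eq_lintegral_ofReal, h1, ENNReal.ofReal_one]
  · by_contra h
    rw [integral_undef h] at h1
    exact zero_ne_one h1
  · filter_upwards [ae_restrict_mem measurableSet_Ioi] with ρ hρ
    have : (0 : ℝ) < ρ := hρ
    positivity

theorem volume_ball_three :
    (volume : Measure (EuclideanSpace ℝ (Fin 3))) (Metric.ball 0 1) =
      ENNReal.ofReal (4 * Real.pi / 3) := by
  rw [EuclideanSpace.volume_ball_fin_three]
  simp
  ring_nf

/-- The Weyl integration formula for class functions on `SU(2)`. -/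
theorem lintegral_haarSU2 {F : ℝ → ENNReal} (hF : Measurable F) :
    ∫⁻ H, F (H.1 0 0).re ∂haarSU2 =
      ∫⁻ φ in Set.Ioo 0 Real.pi, ENNReal.ofReal (2 / Real.pi * Real.sin φ ^ 2) * F (Real.cos φ) := by
  set k : ℝ × ℝ → ENNReal := fun p =>
      ENNReal.ofReal ((Real.pi ^ 2)⁻¹ * Real.exp (-(p.1 ^ 2 + p.2 ^ 2))) *
          F (p.1 / Real.sqrt (p.1 ^ 2 + p.2 ^ 2)) with hk_def
  have hk : Measurable k := by
    refine Measurable.mul (by fun_prop) (hF.comp ?_)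
    exact measurable_fst.div (by fun_prop)
  -- Integrating out the directions in ℝ³ leaves the half-plane (t, r), r > 0, with the sphere area
  -- 4πr² as weight.
  set m : ℝ × ℝ → ENNReal := fun p =>
    (Set.Ioi (0 : ℝ)).indicator (fun r => ENNReal.ofReal (4 * Real.pi * r ^ 2)) p.2 * k p with hm_def
  have hi : Measurable ((Set.Ioi (0 : ℝ)).indicator
      fun r => ENNReal.ofReal (4 * Real.pi * r ^ 2)) :=
    Measurable.indicator (by fun_prop) measurableSet_Ioi
  have hm : Measurable m := (hi.comp measurable_snd).mul hk
  have h1 : ∀ t : ℝ, ∫⁻ y : EuclideanSpace ℝ (Fin 3), k (t, ‖y‖) = ∫⁻ r : ℝ, m (t, r) := by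
    intro t
    have hkt : Measurable fun r => k (t, r) := hk.comp (by fun_prop)
    rw [lintegral_fun_norm_addHaar volume hkt, volume_ball_three, finrank_euclideanSpace,
      Fintype.card_fin, ← lintegral_const_mul _ (by fun_prop), ← lintegral_indicator measurableSet_Ioi]
    refine lintegral_congr fun r => ?_
    simp only [hm_def, Set.indicator]
    split_ifs
    · rw [← mul_assoc, show ((3 : ℕ) : ENNReal) = ENNReal.ofReal 3 by simp,
        ← ENNReal.ofReal_mul (by norm_num), ← ENNReal.ofReal_mul (by positivity)]
      congr 2
      simp only [Nat.add_one_sub_one]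
      ring
    · simp
  have h2 : ∫⁻ H, F (H.1 0 0).re ∂haarSU2 = ∫⁻ p, m p := by
    rw [lintegral_haarSU2_eq hF, Measure.volume_eq_prod, lintegral_prod _ hm.aemeasurable]
    exact lintegral_congr h1
  -- In polar coordinates ρ · 4πρ² sin²φ · π⁻² exp(-ρ²) = 2ρ³ exp(-ρ²) · (2/π) sin²φ. The radial
  -- factor has mass 1, and r > 0 restricts φ to (0, π).
  have h3 : ∀ p ∈ polarCoord.target, ENNReal.ofReal p.1 • m (polarCoord.symm p) =
      ENNReal.ofReal (2 * p.1 ^ 3 * Real.exp (-p.1 ^ 2)) *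
        (Set.Ioi (0 : ℝ)).indicator
          (fun φ => ENNReal.ofReal (2 / Real.pi * Real.sin φ ^ 2) * F (Real.cos φ)) p.2 := by
    rintro ⟨ρ, φ⟩ ⟨hρ, hφ⟩
    have hρ' : 0 < ρ := hρ
    have hpi := Real.pi_pos
    have hr : (ρ * Real.cos φ) ^ 2 + (ρ * Real.sin φ) ^ 2 = ρ ^ 2 := by
      nlinarith [Real.sin_sq_add_cos_sq φ]
    simp only [polarCoord_symm_apply, hm_def, hk_def, hr, Real.sqrt_sq hρ'.le,
      mul_div_cancel_left₀ _ hρ'.ne', smul_eq_mul]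
    by_cases hφ0 : 0 < φ
    · have hs : 0 < Real.sin φ := Real.sin_pos_of_pos_of_lt_pi hφ0 hφ.2
      rw [Set.indicator_of_mem (show ρ * Real.sin φ ∈ Set.Ioi (0 : ℝ) from mul_pos hρ' hs),
        Set.indicator_of_mem (show φ ∈ Set.Ioi (0 : ℝ) from hφ0), ← mul_assoc, ← mul_assoc,
        ← mul_assoc, ← ENNReal.ofReal_mul hρ'.le, ← ENNReal.ofReal_mul (by positivity),
        ← ENNReal.ofReal_mul (by positivity)]
      congr 2
      field_simp
      ring
    · have hs : Real.sin φ ≤ 0 := Real.sin_nonpos_of_nonpos_of_neg_pi_le (not_lt.1 hφ0) hφ.1.le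
      rw [Set.indicator_of_notMem (show ρ * Real.sin φ ∉ Set.Ioi (0 : ℝ) from
          not_lt.2 (mul_nonpos_of_nonneg_of_nonpos hρ'.le hs)),
        Set.indicator_of_notMem (show φ ∉ Set.Ioi (0 : ℝ) from hφ0)]
      simp
  have hg : Measurable fun φ => ENNReal.ofReal (2 / Real.pi * Real.sin φ ^ 2) * F (Real.cos φ) :=
    Measurable.mul (by fun_prop) (hF.comp (by fun_prop))
  rw [h2, ← lintegral_comp_polarCoord_symm,
    setLIntegral_congr_fun polarCoord.open_target.measurableSet h3, polarCoord_target,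
    Measure.volume_eq_prod, ← Measure.prod_restrict,
    lintegral_prod_mul (f := fun ρ => ENNReal.ofReal (2 * ρ ^ 3 * Real.exp (-ρ ^ 2)))
      (g := (Set.Ioi (0 : ℝ)).indicator
        fun φ => ENNReal.ofReal (2 / Real.pi * Real.sin φ ^ 2) * F (Real.cos φ))
      (by fun_prop) (hg.indicator measurableSet_Ioi).aemeasurable,
    lintegral_two_mul_pow_three_mul_exp, one_mul, lintegral_indicator measurableSet_Ioi,
    Measure.restrict_restrict measurableSet_Ioi]
  congr 2
  ext φ
  constructor
  · rintro ⟨ha, hb⟩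
    exact ⟨ha, hb.2⟩
  · rintro ⟨ha, hb⟩
    exact ⟨ha, (neg_neg_of_pos Real.pi_pos).trans ha, hb⟩

/-- The class angle of an element of `SU(2)`. -/
def classAngle (H : SU2) : ℝ := Real.arccos (H.1 0 0).re

theorem cos_classAngle (H : SU2) : (H.1 0 0).re = Real.cos (classAngle H) := by
  have h := (Complex.abs_re_le_norm (H.1 0 0)).trans (entry_norm_bound_of_unitary H.2.1 0 0)
  rw [abs_le] at h
  exact (Real.cos_arccos h.1 h.2).symm

theorem measurable_classAngle : Measurable classAngle :=
  Real.continuous_arccos.measurable.comp measurable_re_apply_zero_zero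

/-- The Weyl formula for indicators, since `arccos` inverts `cos` on (0, π). -/
theorem map_classAngle_haarSU2 :
    haarSU2.map classAngle = (volume.restrict (Set.Ioo 0 Real.pi)).withDensity
      fun φ => ENNReal.ofReal (2 / Real.pi * Real.sin φ ^ 2) := by
  ext s hs
  have hF : Measurable ((Real.arccos ⁻¹' s).indicator fun _ => (1 : ENNReal)) :=
    measurable_const.indicator (Real.continuous_arccos.measurable hs)
  have h := lintegral_haarSU2 hF
  rw [Measure.map_apply measurable_classAngle hs, withDensity_apply _ hs]
  have h1 : haarSU2 (classAngle ⁻¹' s) =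
      ∫⁻ H, (Real.arccos ⁻¹' s).indicator (fun _ => (1 : ENNReal)) (H.1 0 0).re ∂haarSU2 := by
    rw [← lintegral_indicator_one (measurable_classAngle hs)]
    rfl
  rw [h1, h, ← lintegral_indicator hs]
  refine setLIntegral_congr_fun measurableSet_Ioo fun φ hφ => ?_
  have hφs : Real.cos φ ∈ Real.arccos ⁻¹' s ↔ φ ∈ s := by
    rw [Set.mem_preimage, Real.arccos_cos hφ.1.le hφ.2.le]
  by_cases hs' : φ ∈ s
  · simp only [Set.indicator_of_mem hs', Set.indicator_of_mem (hφs.2 hs'), mul_one]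
  · simp only [Set.indicator_of_notMem hs', Set.indicator_of_notMem (mt hφs.1 hs'), mul_zero]

end
end PonzanoRegge

/-! ### Regularity and symmetry in the class angle. -/

namespace PonzanoRegge
noncomputable section

variable {Nt Nx : ℕ}

theorem analyticAt_modeDet_angle (Nt Nx : ℕ) (Nγ : ℤ) (p : ℂ × ℂ) (φ : ℝ) :
    AnalyticAt ℝ (fun φ => modeDet Nt Nx Nγ φ p) φ := by
  unfold modeDet
  refine Finset.analyticAt_fun_prod _ fun ω _ => Finset.analyticAt_fun_prod _ fun k _ => ?_
  have h : AnalyticAt ℝ (fun φ : ℝ => (Real.cos (modeAngle Nt Nx Nγ φ ω k) : ℂ)) φ := by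
    refine (Complex.ofRealCLM.analyticAt _).comp (Real.analyticAt_cos.comp ?_)
    unfold modeAngle
    fun_prop
  simp only [det_modeMatrix]
  fun_prop

theorem classAngleIntegrand_eq (Nγ : ℤ) (lam tau : ℂ) (φ : ℝ) :
    classAngleIntegrand Nt Nx Nγ lam tau φ =
      (Real.sin φ : ℂ) ^ 2 * (modeDet Nt Nx Nγ φ (lam, tau))⁻¹ := by
  simp only [classAngleIntegrand, modeDet, one_div, Finset.prod_inv_distrib]

/-- The angles φ and 2π - φ label the same conjugacy class. -/
theorem classAngleIntegrand_two_pi_sub [NeZero Nt] [NeZero Nx] (Nγ : ℤ) (lam tau : ℂ) (φ : ℝ) :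
    classAngleIntegrand Nt Nx Nγ lam tau (2 * Real.pi - φ) =
      classAngleIntegrand Nt Nx Nγ lam tau φ := by
  rw [classAngleIntegrand_eq, classAngleIntegrand_eq, Real.sin_two_pi_sub,
    modeDet_congr Nγ (Real.cos_two_pi_sub φ)]
  simp

end
end PonzanoRegge

/-- A function on `[0, 2a]` symmetric about `a` is integrable iff it is so on `[0, a]`. -/
theorem intervalIntegrable_two_mul_iff {E : Type*} [NormedAddCommGroup E] {f : ℝ → E} {a : ℝ}
    (ha : 0 ≤ a) (hf : ∀ x, f (2 * a - x) = f x) :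
    IntervalIntegrable f volume 0 (2 * a) ↔ IntervalIntegrable f volume 0 a := by
  constructor
  · intro h
    refine h.mono_set ?_
    rw [Set.uIcc_of_le ha, Set.uIcc_of_le (by linarith)]
    exact Set.Icc_subset_Icc le_rfl (by linarith)
  · intro h
    have h1 := h.comp_sub_left (2 * a)
    simp only [hf, sub_zero, show 2 * a - a = a by ring] at h1
    exact h.trans h1.symm

theorem integral_two_mul_eq {E : Type*} [NormedAddCommGroup E] [NormedSpace ℝ E] {f : ℝ → E} {a : ℝ}
    (hf : ∀ x, f (2 * a - x) = f x) (h : IntervalIntegrable f volume 0 a) :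
    ∫ x in (0 : ℝ)..(2 * a), f x = (2 : ℝ) • ∫ x in (0 : ℝ)..a, f x := by
  have h1 := h.comp_sub_left (2 * a)
  simp only [hf, sub_zero, show 2 * a - a = a by ring] at h1
  rw [← intervalIntegral.integral_add_adjacent_intervals h h1.symm, two_smul]
  congr 1
  have := intervalIntegral.integral_comp_sub_left (a := 0) (b := a) f (2 * a)
  simp only [hf, sub_zero, show 2 * a - a = a by ring] at this
  exact this.symm

/-! ### The amplitude as a class angle integral. -/

namespace PonzanoRegge
noncomputable section

variable {Nt Nx : ℕ}

theorem integrable_classAngle_iff {G : ℝ → ℂ} (hG : Measurable G) :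
    Integrable (fun H => G (classAngle H)) haarSU2 ↔
      IntervalIntegrable (fun φ => (Real.sin φ : ℂ) ^ 2 * G φ) volume 0 Real.pi := by
  have h1 := integrable_map_measure (μ := haarSU2) (f := classAngle) (g := G)
    hG.aestronglyMeasurable measurable_classAngle.aemeasurable
  have hm : Measurable fun φ : ℝ => ENNReal.ofReal (2 / Real.pi * Real.sin φ ^ 2) := by fun_prop
  rw [show (fun H => G (classAngle H)) = G ∘ classAngle from rfl, ← h1, map_classAngle_haarSU2,
    integrable_withDensity_iff_integrable_smul' hm (by simp),
    intervalIntegrable_iff_integrableOn_Ioo_of_le Real.pi_pos.le, IntegrableOn]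
  have h2 : ∀ φ : ℝ, (ENNReal.ofReal (2 / Real.pi * Real.sin φ ^ 2)).toReal • G φ =
      (2 / Real.pi : ℝ) • ((Real.sin φ : ℂ) ^ 2 * G φ) := by
    intro φ
    have hpi := Real.pi_pos
    rw [ENNReal.toReal_ofReal (by positivity), mul_smul]
    congr 1
    rw [Complex.real_smul, Complex.ofReal_pow]
  simp only [h2]
  exact integrable_smul_iff (show (2 / Real.pi : ℝ) ≠ 0 by positivity) _

theorem integral_classAngle {G : ℝ → ℂ} (hG : Measurable G) :
    ∫ H, G (classAngle H) ∂haarSU2 =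
      (2 / Real.pi : ℝ) • ∫ φ in (0 : ℝ)..Real.pi, (Real.sin φ : ℂ) ^ 2 * G φ := by
  have h1 := integral_map (μ := haarSU2) (φ := classAngle) (f := G)
    measurable_classAngle.aemeasurable hG.aestronglyMeasurable
  have hm : Measurable fun φ : ℝ => ENNReal.ofReal (2 / Real.pi * Real.sin φ ^ 2) := by fun_prop
  rw [← h1, map_classAngle_haarSU2, integral_withDensity_eq_integral_toReal_smul hm (by simp),
    intervalIntegral.integral_of_le Real.pi_pos.le, integral_Ioc_eq_integral_Ioo,
    ← integral_smul]
  refine integral_congr_ae (ae_of_all _ fun φ => ?_)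
  have hpi := Real.pi_pos
  simp only
  rw [ENNReal.toReal_ofReal (by positivity), mul_smul]
  congr 1
  rw [Complex.real_smul, Complex.ofReal_pow]

/-- Real analyticity in the angle leaves only countably many zeros, and the law of the class angle
is absolutely continuous. -/
theorem ae_modeDet_ne_zero (Nγ : ℤ) {p : ℂ × ℂ} {φ₀ : ℝ} (h : modeDet Nt Nx Nγ φ₀ p ≠ 0) :
    ∀ᵐ H ∂haarSU2, modeDet Nt Nx Nγ (classAngle H) p ≠ 0 := by
  have h1 := AnalyticOnNhd.countable_zeros (𝕜 := ℝ)
    (fun φ _ => analyticAt_modeDet_angle Nt Nx Nγ p φ) h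
  have h2 : ∀ᵐ φ ∂(haarSU2.map classAngle), modeDet Nt Nx Nγ φ p ≠ 0 := by
    rw [map_classAngle_haarSU2]
    refine (withDensity_absolutelyContinuous _ _).ae_le (ae_restrict_of_ae ?_)
    simpa using h1.ae_notMem volume
  exact ae_of_ae_map measurable_classAngle.aemeasurable h2

theorem measurable_modeDet_angle_inv (Nγ : ℤ) (p : ℂ × ℂ) :
    Measurable fun φ => (modeDet Nt Nx Nγ φ p)⁻¹ := by
  have : Continuous fun φ => modeDet Nt Nx Nγ φ p :=
    continuous_iff_continuousAt.2 fun φ => (analyticAt_modeDet_angle Nt Nx Nγ p φ).continuousAt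
  exact this.measurable.inv

variable [NeZero Nt] [NeZero Nx]

theorem integrable_boundaryState_iff (Nγ : ℤ) (lam tau : ℂ) :
    Integrable (fun H : SU2 => boundaryState Nγ lam tau (torusHolonomies Nt Nx H)) haarSU2 ↔
      IntervalIntegrable (classAngleIntegrand Nt Nx Nγ lam tau) volume 0 (2 * Real.pi) := by
  rw [intervalIntegrable_two_mul_iff Real.pi_pos.le (classAngleIntegrand_two_pi_sub Nγ lam tau)]
  simp only [boundaryState_torusHolonomies Nγ lam tau _ (cos_classAngle _)]
  rw [integrable_classAngle_iff (measurable_modeDet_angle_inv Nγ _)]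
  simp only [← classAngleIntegrand_eq]

theorem amplitude_boundaryState (Nγ : ℤ) (lam tau : ℂ) :
    amplitude (Nt := Nt) (Nx := Nx) (boundaryState Nγ lam tau) =
      (1 / Real.pi : ℂ) * ∫ φ in (0 : ℝ)..(2 * Real.pi), classAngleIntegrand Nt Nx Nγ lam tau φ := by
  by_cases h : IntervalIntegrable (classAngleIntegrand Nt Nx Nγ lam tau) volume 0 (2 * Real.pi)
  · have hs := classAngleIntegrand_two_pi_sub (Nt := Nt) (Nx := Nx) Nγ lam tau
    rw [integral_two_mul_eq hs ((intervalIntegrable_two_mul_iff Real.pi_pos.le hs).1 h), amplitude]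
    simp only [boundaryState_torusHolonomies Nγ lam tau _ (cos_classAngle _)]
    rw [integral_classAngle (measurable_modeDet_angle_inv Nγ _)]
    simp only [← classAngleIntegrand_eq, Complex.real_smul]
    push_cast
    ring
  -- Without integrability both Bochner integrals take the default value 0.
  · rw [intervalIntegral.integral_undef h, mul_zero, amplitude,
      integral_undef (mt (integrable_boundaryState_iff Nγ lam tau).1 h)]

end
end PonzanoRegge

theorem mainTheorem3 (Nt Nx : ℕ) [NeZero Nt] [NeZero Nx] (Nγ : ℤ) (lam tau : ℂ) :
    -- the mode determinants
    (∀ (φ : ℝ) (ω k : ℕ),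
      (PonzanoRegge.modeMatrix Nt Nx Nγ lam tau φ ω k).det =
        1 + lam ^ 2 + tau ^ 2 - 2 * tau * (Real.cos (2 * Real.pi * k / Nx) : ℂ)
          - 2 * lam * (Real.cos (PonzanoRegge.modeAngle Nt Nx Nγ φ ω k) : ℂ)
          + 2 * lam * tau * (Real.cos (2 * Real.pi * k / Nx) : ℂ)
              * (Real.cos (PonzanoRegge.modeAngle Nt Nx Nγ φ ω k) : ℂ)) ∧
    -- inside the domain of convergence, the boundary state is the sum of its series
    (‖lam‖ + ‖tau‖ < 1 →
      (∀ (φ : ℝ) (ω k : ℕ), (PonzanoRegge.modeMatrix Nt Nx Nγ lam tau φ ω k).det ≠ 0) ∧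
      ∀ H : PonzanoRegge.SU2,
        Summable (PonzanoRegge.coherentTerm Nγ (fun _ => lam) (fun _ => tau)
          (PonzanoRegge.torusHolonomies Nt Nx H)) ∧
        PonzanoRegge.boundaryState Nγ lam tau (PonzanoRegge.torusHolonomies Nt Nx H) =
          PonzanoRegge.coherentSeries Nγ (fun _ => lam) (fun _ => tau)
            (PonzanoRegge.torusHolonomies Nt Nx H)) ∧
    -- the amplitude, for all couplings at which no determinant vanishes identically
    ((∃ φ : ℝ, ∀ ω < Nt, ∀ k < Nx,
        (PonzanoRegge.modeMatrix Nt Nx Nγ lam tau φ ω k).det ≠ 0) →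
      (∀ᵐ H ∂PonzanoRegge.haarSU2, ∃! z : ℂ, PonzanoRegge.IsContinuedValue
        (PonzanoRegge.homogeneousSeries Nγ (PonzanoRegge.torusHolonomies Nt Nx H))
        (lam, tau) z) ∧
      (MeasureTheory.Integrable
          (fun H : PonzanoRegge.SU2 =>
            PonzanoRegge.boundaryState Nγ lam tau (PonzanoRegge.torusHolonomies Nt Nx H))
          PonzanoRegge.haarSU2 ↔
        IntervalIntegrable (PonzanoRegge.classAngleIntegrand Nt Nx Nγ lam tau)
          MeasureTheory.volume 0 (2 * Real.pi)) ∧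
      PonzanoRegge.amplitude (Nt := Nt) (Nx := Nx) (PonzanoRegge.boundaryState Nγ lam tau) =
        (1 / Real.pi : ℂ) * ∫ φ in (0 : ℝ)..(2 * Real.pi),
          PonzanoRegge.classAngleIntegrand Nt Nx Nγ lam tau φ) := by
  refine ⟨PonzanoRegge.det_modeMatrix Nt Nx Nγ lam tau, fun hlt =>
    ⟨PonzanoRegge.det_modeMatrix_ne_zero Nt Nx Nγ hlt, fun H =>
      ⟨(PonzanoRegge.hasSum_coherentTerm Nγ hlt _).summable, ?_⟩⟩, ?_⟩
  · rw [PonzanoRegge.boundaryState_torusHolonomies Nγ lam tau H (PonzanoRegge.cos_classAngle H),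
      PonzanoRegge.coherentSeries_torusHolonomies Nγ hlt H (PonzanoRegge.cos_classAngle H)]
  · rintro ⟨φ, hφ⟩
    have h : PonzanoRegge.modeDet Nt Nx Nγ φ (lam, tau) ≠ 0 :=
      Finset.prod_ne_zero_iff.2 fun ω hω => Finset.prod_ne_zero_iff.2 fun k hk =>
        hφ ω (Finset.mem_range.1 hω) k (Finset.mem_range.1 hk)
    refine ⟨?_, PonzanoRegge.integrable_boundaryState_iff Nγ lam tau,
      PonzanoRegge.amplitude_boundaryState Nγ lam tau⟩
    filter_upwards [PonzanoRegge.ae_modeDet_ne_zero Nγ h] with H hH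
    exact PonzanoRegge.existsUnique_isContinuedValue Nγ H (PonzanoRegge.cos_classAngle H) hH
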